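/- Let $D\subset\mathbb{C}$ be a bounded domain (non-empty, open, connected) that is regular for the Dirichlet problem, i.e. every continuous function on $\partial D$ has a harmonic extension to $D$ that is continuous on $\bar D$ (for instance, any bounded simply connected domain). For $x\in D$ let $G_D(x,y)=\log\frac1{|x-y|}+\tilde G^x(y)$ be the Green's function of $D$, where $\tilde G^x$ is the harmonic extension to $D$ of the function $-\log\frac1{|x-\cdot|}$ on $\partial D$. Let $C(x,D)$ be the conformal radius of $D$ viewed from $x$: $C(x,D)=|\varphi'(x)|^{-1}$ if $\varphi$ is a conformal map from $D$ onto the unit disc with $\varphi(x)=0$, and $C(x,D)=e^{\tilde G^x(x)}$ if no such map exists. (When such a map exists, $|\varphi'(x)|^{-1}=e^{\tilde G^x(x)}$ as well.) Let $\mathcal H^1_0(D)$ be the closure of $C_c^\infty(D)$ for the norm associated with $\langle f,g\rangle_\nabla=\frac1{2\pi}\int_D\nabla f\cdot\nabla g$, let $(e_n)$ be an orthonormal basis of it, let $(a_n)$ be independent $\mathcal N(0,1)$ variables, and let $h=\sum_n a_ne_n$ be the Gaussian Free Field in $D$ with Dirichlet boundary conditions; for $f\in\mathcal H^1_0(D)$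 put $\langle h,f\rangle_\nabla=\sum_n a_n\langle e_n,f\rangle_\nabla$ (almost sure limit of the partial sums). For $\epsilon>0$ and $z\in D$ let $$G^z_\epsilon(y)=\log\frac1{\epsilon\vee|z-y|}+\tilde G^z_\epsilon(y),$$ where $\tilde G^z_\epsilon$ is the harmonic extension to $D$ of the function $\log(\epsilon\vee|z-\cdot|)$ on $\partial D$ (so $\tilde G^z_\epsilon=\tilde G^z$ when $\epsilon\le d(z,\partial D)$), and let $h_\epsilon(z)=\langle h,G^z_\epsilon\rangle_\nabla$, in any version that for each $\epsilon$ is jointly measurable in $z$ and the randomness. For $\gamma\ge0$ let $\mu_\epsilon$ be the random measure $d\mu_\epsilon(z)=\epsilon^{\gamma^2/2}e^{\gamma h_\epsilon(z)}\,dz$ on $D$, and write $\mu_\epsilon(\phi)=\int_D\phi\,d\mu_\epsilon$. Lemma. If $\gamma\in[0,\sqrt2)$, then for every continuous function $\phi:\bar D\to\mathbb{R}$: for every $\epsilon>0$, $\phi$ is almost surely $\mu_\epsilon$-integrable and $\mu_\epsilon(\phi)\in L^2$; the function $\phi(x)\phi(y)[C(x,D)C(y,D)]^{\gamma^2/2}e^{\gamma^2G_D(x,y)}$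 is integrable on $D\times D$; and $$\mathbb{E}\big[\mu_\epsilon(\phi)^2\big]\;\longrightarrow\;\iint_{D\times D}\phi(x)\phi(y)\,[C(x,D)C(y,D)]^{\gamma^2/2}\,e^{\gamma^2G_D(x,y)}\,dx\,dy\qquad(\epsilon\to0).$$ -/

import Mathlib

open MeasureTheory ProbabilityTheory Filter Topology Set
open scoped Gradient

noncomputable section

/-! ### Harmonic extensions, Green's function, conformal radius -/

/-- `u` is a harmonic extension to `D` of the boundary function `g : ∂D → ℝ`: it is continuous on
the closure of `D`, harmonic in `D`, and equal to `g` on `∂D`. -/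
structure IsHarmonicExtension (D : Set ℂ) (g u : ℂ → ℝ) : Prop where
  continuousOn : ContinuousOn u (closure D)
  harmonic : InnerProductSpace.HarmonicOnNhd u D
  boundary : ∀ y ∈ frontier D, u y = g y

/-- `D` is regular for the Dirichlet problem: each continuous function on `∂D` has a harmonic
extension to `D`. -/
def DirichletRegular (D : Set ℂ) : Prop :=
  ∀ g : ℂ → ℝ, ContinuousOn g (frontier D) → ∃ u : ℂ → ℝ, IsHarmonicExtension D g u

open Classical in
/-- The harmonic extension to `D` of `g : ∂D → ℝ`. On a bounded open set its values on the closure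
of `D` are unique by the maximum principle. -/
def harmonicExtension (D : Set ℂ) (g : ℂ → ℝ) : ℂ → ℝ :=
  if h : ∃ u : ℂ → ℝ, IsHarmonicExtension D g u then h.choose else 0

/-- The harmonic correction `G̃^x(y)`: the harmonic extension to `D` of the function
`- log (1 / |x - y|)` on `∂D`. -/
def greenCorrection (D : Set ℂ) (x : ℂ) : ℂ → ℝ :=
  harmonicExtension D (fun y => Real.log ‖x - y‖)

/-- The Green's function `G_D(x, y) = log (1 / |x - y|) + G̃^x(y)` with zero boundary values. -/
def greenFunction (D : Set ℂ) (x y : ℂ) : ℝ :=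
  -Real.log ‖x - y‖ + greenCorrection D x y

/-- The regularized Green's function
`G^x_ε(y) = log (1 / max ε |x - y|) + (harmonic extension of log (max ε |x - ·|) from ∂D)(y)`.

If `ε ≤ dist(x, ∂D)`, then `max ε |x - ·| = |x - ·|` on `∂D`, and the harmonic term is just
`G̃^x(y)`. For `x` closer to `∂D` the harmonic term depends on `ε`, so that `G^x_ε` still vanishes
on `∂D` and `-Δ G^x_ε / (2π)` is the uniform measure on the circle of radius `ε` around `x`,
restricted to `D`. -/
def regularizedGreen (D : Set ℂ) (ε : ℝ) (x y : ℂ) : ℝ :=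
  -Real.log (max ε ‖x - y‖) + harmonicExtension D (fun w => Real.log (max ε ‖x - w‖)) y

/-- `φ` is a conformal map from `D` onto the unit disc with `φ x = 0`. -/
structure IsConformalMapToDisc (D : Set ℂ) (x : ℂ) (φ : ℂ → ℂ) : Prop where
  differentiableOn : DifferentiableOn ℂ φ D
  bijOn : BijOn φ D (Metric.ball 0 1)
  map_center : φ x = 0

open Classical in
/-- The conformal radius `C(x, D)`. If there is a conformal map `φ` from `D` onto the unit disc
with `φ x = 0` (the value does not depend on its choice), it is `|φ'(x)|⁻¹`. If `D` is not simply
connected there is no such map, and `C(x, D)` is given by `log C(x, D) = G̃^x(x)`, an identity that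
also holds in the first case. -/
def conformalRadius (D : Set ℂ) (x : ℂ) : ℝ :=
  if h : ∃ φ : ℂ → ℂ, IsConformalMapToDisc D x φ then ‖deriv h.choose x‖⁻¹
  else Real.exp (greenCorrection D x x)

/-! ### The Sobolev space with norm `‖f‖² = (1 / 2π) ∫_D |∇ f|²` -/

/-- The measure `dx / (2π)` on `D`. -/
def dirichletMeasure (D : Set ℂ) : Measure ℂ :=
  ENNReal.ofReal (1 / (2 * Real.pi)) • volume.restrict D

/-- Smooth real functions on `ℂ` with compact support contained in `D`. -/
structure IsTestFunction (D : Set ℂ) (f : ℂ → ℝ) : Prop where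
  smooth : ContDiff ℝ ((⊤ : ℕ∞) : WithTop ℕ∞) f
  compact : HasCompactSupport f
  support : tsupport f ⊆ D

/-- The (classes of) gradients of test functions, in `L²(D, dx / (2π); ℝ²)`. -/
def testGradients (D : Set ℂ) : Submodule ℝ (Lp ℂ 2 (dirichletMeasure D)) where
  carrier := {F | ∃ f : ℂ → ℝ, IsTestFunction D f ∧ F =ᵐ[dirichletMeasure D] ∇ f}
  zero_mem' := by
    refine ⟨fun _ => 0, ⟨contDiff_const, HasCompactSupport.zero, ?_⟩, ?_⟩
    · simp [tsupport]
    · filter_upwards [Lp.coeFn_zero ℂ 2 (dirichletMeasure D)] with x hx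
      rw [hx]
      simp [gradient]
  add_mem' := by
    rintro F F' ⟨f, hf, hF⟩ ⟨f', hf', hF'⟩
    refine ⟨f + f', ⟨hf.smooth.add hf'.smooth, hf.compact.add hf'.compact, ?_⟩, ?_⟩
    · exact (tsupport_add f f').trans (union_subset hf.support hf'.support)
    · filter_upwards [Lp.coeFn_add F F', hF, hF'] with x hx h h'
      rw [hx, Pi.add_apply, h, h', gradient, gradient, gradient,
        fderiv_add (hf.smooth.differentiable (by simp) x) (hf'.smooth.differentiable (by simp) x),
        map_add]
  smul_mem' := by
    rintro c F ⟨f, hf, hF⟩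
    refine ⟨c • f, ⟨hf.smooth.const_smul c, ?_, ?_⟩, ?_⟩
    · exact hf.compact.smul_left (f := fun _ => c)
    · exact (closure_mono (Function.support_const_smul_subset c f)).trans hf.support
    · filter_upwards [Lp.coeFn_smul c F, hF] with x hx h
      rw [hx, Pi.smul_apply, h, gradient, gradient,
        fderiv_const_smul (hf.smooth.differentiable (by simp) x)]
      simp

/-- The Hilbert space `H¹₀(D)`, the closure of the test functions on `D` for the norm
`‖f‖² = (1 / 2π) ∫_D |∇ f|²`. An element `f` is represented by its gradient, so that this is the
closure of the gradients of the test functions in `L²(D, dx / (2π); ℝ²)`; its inner product is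
`⟨f, g⟩ = (1 / 2π) ∫_D ∇ f · ∇ g`. -/
def SobolevH10 (D : Set ℂ) : Submodule ℝ (Lp ℂ 2 (dirichletMeasure D)) :=
  (testGradients D).topologicalClosure

/-- `⟨e, f⟩ = (1 / 2π) ∫_D ∇ e · ∇ f`, where `e ∈ H¹₀(D)` and `f` is an (almost everywhere
differentiable) function. -/
def dirichletInner {D : Set ℂ} (e : SobolevH10 D) (f : ℂ → ℝ) : ℝ :=
  ∫ y, inner ℝ ((e : Lp ℂ 2 (dirichletMeasure D)) y) (∇ f y) ∂(dirichletMeasure D)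

/-! ### The Gaussian free field -/

/-- A Gaussian free field `h = ∑ aₙ eₙ` in `D` with Dirichlet boundary conditions: an orthonormal
basis `(eₙ)` of `H¹₀(D)` together with independent standard Gaussian variables `(aₙ)`. -/
structure GaussianFreeField {Ω : Type*} [MeasurableSpace Ω] (D : Set ℂ) (P : Measure Ω) where
  basis : HilbertBasis ℕ ℝ (SobolevH10 D)
  coord : ℕ → Ω → ℝ
  law : ∀ n, HasLaw (coord n) (gaussianReal 0 1) P
  indep : iIndepFun coord P

/-- The random variable `⟨h, f⟩ = ∑ aₙ αₙ` for `f = ∑ αₙ eₙ ∈ H¹₀(D)`, as the (almost sure) limit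
of the partial sums. -/
def GaussianFreeField.pairing {Ω : Type*} [MeasurableSpace Ω] {D : Set ℂ} {P : Measure Ω}
    (h : GaussianFreeField D P) (f : ℂ → ℝ) (ω : Ω) : ℝ :=
  limUnder atTop
    (fun N : ℕ => ∑ n ∈ Finset.range N, h.coord n ω * dirichletInner (h.basis n) f)

/-- `hReg ε z ω` is the `ε`-regularization `h_ε(z) = ⟨h, G^z_ε⟩` of the Gaussian free field `h`.
Each single variable `h_ε(z)` is defined up to a null set; as usual for a random function, it is
understood as a version which is jointly measurable in `(z, ω)`. -/
structure IsRegularization {Ω : Type*} [MeasurableSpace Ω] {D : Set ℂ} {P : Measure Ω}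
    (h : GaussianFreeField D P) (hReg : ℝ → ℂ → Ω → ℝ) : Prop where
  version : ∀ ε : ℝ, 0 < ε → ∀ z ∈ D, hReg ε z =ᵐ[P] h.pairing (regularizedGreen D ε z)
  measurable : ∀ ε : ℝ, 0 < ε →
    AEMeasurable (fun p : ℂ × Ω => hReg ε p.1 p.2) ((volume.restrict D).prod P)

/-- The measure `ε ^ (γ² / 2) * exp (γ * hε z) dz` on `D`, for a function `hε` on `D`. -/
def liouvilleApprox (D : Set ℂ) (γ ε : ℝ) (hε : ℂ → ℝ) : Measure ℂ :=
  (volume.restrict D).withDensity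
    (fun z => ENNReal.ofReal (ε ^ (γ ^ 2 / 2) * Real.exp (γ * hε z)))

end

/-! The second moment is computed exactly for each ε, and the limit is taken by dominated
convergence. By Fubini, E[μ_ε(φ)²] is the integral of φ(x)φ(y) against the two-point function
`liouvilleKernel`. Since h_ε(x) + h_ε(y) is a centred Gaussian whose variance is the squared
Dirichlet norm of G^x_ε + G^y_ε, that function is ε^(γ²) exp(γ²/2 · ‖G^x_ε + G^y_ε‖²)
(`liouvilleApprox_second_moment`).

Everything rests on `inner_greenLp`: ⟨G^x_ε, G^y_ε⟩ is the average over the circle of radius ε about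
y of G^x_ε, extended by zero outside D. For test functions in place of G^x_ε this is a computation
in polar coordinates. The boundary of D may be rough, so one cannot integrate by parts up to it.
Instead the truncations T = (G - δ)⁺ are Lipschitz with compact support in D, and mollification
extends the identity to them. As ∇T · ∇G = |∇T|², it bounds the energy of T uniformly in δ. Letting
δ → 0 shows that G has finite energy, belongs to H¹₀(D), and satisfies the identity.

Pointwise limit: when 2ε < |x - y| and both closed ε-discs lie in D, the mean value property turns
the circle averages into -log ε + G̃^x(x), -log ε + G̃^y(y) and G_D(x, y). The powers of ε cancel,
so the kernel equals its limit for all small ε; `conformalRadius_eq_exp` rewrites exp(G̃^x(x)) as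
C(x, D).

Domination: the maximum principle bounds the variances by log(R/ε) and the covariance by log(2R/|x -
y|), also for points near ∂D. The kernel is therefore at most a constant times |x - y|^(-γ²)
(`liouvilleKernel_le_rpow`), which is integrable in the plane because γ² < 2. -/

open InnerProductSpace Real
open scoped NNReal ENNReal Convolution

/-! ### Maximum principle and uniqueness of harmonic extensions -/

/-- The circle average of `|z|²`. -/
lemma circleAverage_normSq (c : ℂ) (r : ℝ) :
    circleAverage (fun z => ‖z‖ ^ 2) c r = ‖c‖ ^ 2 + r ^ 2 := by
  have h1 : circleAverage (fun z => ‖z‖ ^ 2) c r =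
      circleAverage (fun z => (‖c‖ ^ 2 + r ^ 2 - 2 * ‖c‖ ^ 2) + 2 * (inner ℝ c z : ℝ)) c r := by
    apply circleAverage_congr_sphere
    intro z hz
    have hz' : ‖z - c‖ ^ 2 = r ^ 2 := by
      rw [mem_sphere_iff_norm.1 hz, sq_abs]
    have := norm_sub_sq_real z c
    rw [real_inner_comm] at this
    simp only
    linarith
  have h2 : HarmonicOnNhd (fun z : ℂ => (‖c‖ ^ 2 + r ^ 2 - 2 * ‖c‖ ^ 2) + 2 * (inner ℝ c z : ℝ))
      (Metric.closedBall c |r|) := by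
    intro z _
    have : HarmonicAt (fun z : ℂ => (inner ℝ c z : ℝ)) z := by
      have e : (fun z : ℂ => (inner ℝ c z : ℝ)) = fun z => (starRingEnd ℂ c * z).re := by
        ext z; simp [Complex.inner]
        ring
      rw [e]
      exact AnalyticAt.harmonicAt_re (by fun_prop)
    exact (harmonicAt_const _).add (this.const_smul (c := 2))
  rw [h1, InnerProductSpace.HarmonicOnNhd.circleAverage_eq h2, real_inner_self_eq_norm_sq]
  ring

/-- The maximum principle for harmonic functions on a bounded open set. -/
lemma InnerProductSpace.HarmonicOnNhd.le_of_frontier_le {U : Set ℂ} {u : ℂ → ℝ} {M : ℝ} (hU : IsOpen U)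
    (hb : Bornology.IsBounded U) (hc : ContinuousOn u (closure U)) (hu : HarmonicOnNhd u U)
    (hM : ∀ y ∈ frontier U, u y ≤ M) : ∀ y ∈ closure U, u y ≤ M := by
  intro y hy
  obtain ⟨R, hR⟩ := hb.closure.exists_norm_le
  have hcomp : IsCompact (closure U) := hb.isCompact_closure
  -- Adding δ|z|² makes u strictly subharmonic: its circle averages exceed the value at the centre
  -- by δr², so a maximum cannot lie in the interior.
  have key : ∀ δ > 0, u y ≤ M + δ * R ^ 2 := by
    intro δ hδ
    obtain ⟨z, hz, hmax⟩ := hcomp.exists_isMaxOn ⟨y, hy⟩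
      (f := fun z => u z + δ * ‖z‖ ^ 2) (by fun_prop)
    have hyz := hmax hy
    simp only [mem_ofPred_eq] at hyz
    have hzF : z ∈ frontier U := by
      rw [frontier, hU.interior_eq]
      refine ⟨hz, fun hzU => ?_⟩
      obtain ⟨r, hr, hball⟩ := Metric.nhds_basis_closedBall.mem_iff.1 (hU.mem_nhds hzU)
      have hrr : |r| = r := abs_of_pos hr
      have hcircle : CircleIntegrable u z r :=
        (hc.mono ((Metric.sphere_subset_closedBall.trans (hrr.symm ▸ hball)).trans
          subset_closure)).circleIntegrable'
      have hcircle2 : CircleIntegrable (fun w : ℂ => δ * ‖w‖ ^ 2) z r :=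
        (by fun_prop : Continuous (fun w : ℂ => δ * ‖w‖ ^ 2)).continuousOn.circleIntegrable'
      have hav : circleAverage (fun w => u w + δ * ‖w‖ ^ 2) z r =
          u z + δ * (‖z‖ ^ 2 + r ^ 2) := by
        rw [circleAverage_fun_add hcircle hcircle2,
          HarmonicOnNhd.circleAverage_eq (hu.mono (hrr.symm ▸ hball))]
        have := circleAverage_fun_smul (a := δ) (f := fun z : ℂ => ‖z‖ ^ 2) (c := z) (R := r)
        simp only [smul_eq_mul] at this
        rw [this, circleAverage_normSq]
      have hle : circleAverage (fun w => u w + δ * ‖w‖ ^ 2) z r ≤ u z + δ * ‖z‖ ^ 2 := by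
        refine circleAverage_mono_on_of_le_circle (hcircle.add hcircle2) fun w hw => ?_
        exact hmax (subset_closure (hball (hrr ▸ Metric.sphere_subset_closedBall hw)))
      rw [hav] at hle
      nlinarith [mul_pos hδ (pow_pos hr 2)]
    have h1 := hM z hzF
    have h2 : δ * ‖z‖ ^ 2 ≤ δ * R ^ 2 := by gcongr; exact hR z hz
    have h3 : 0 ≤ δ * ‖y‖ ^ 2 := by positivity
    linarith
  have hlim : Tendsto (fun δ : ℝ => M + δ * R ^ 2) (𝓝[>] 0) (𝓝 (M + 0 * R ^ 2)) :=
    ((by fun_prop : Continuous fun δ : ℝ => M + δ * R ^ 2).tendsto 0).mono_left nhdsWithin_le_nhds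
  simp only [zero_mul, add_zero] at hlim
  exact ge_of_tendsto hlim (eventually_mem_nhdsWithin.mono key)

/-- The minimum principle for harmonic functions on a bounded open set. -/
lemma InnerProductSpace.HarmonicOnNhd.ge_of_frontier_ge {U : Set ℂ} {u : ℂ → ℝ} {M : ℝ} (hU : IsOpen U)
    (hb : Bornology.IsBounded U) (hc : ContinuousOn u (closure U)) (hu : HarmonicOnNhd u U)
    (hM : ∀ y ∈ frontier U, M ≤ u y) : ∀ y ∈ closure U, M ≤ u y := by
  intro y hy
  have := HarmonicOnNhd.le_of_frontier_le (M := -M) hU hb hc.neg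
    (fun y hy => (hu y hy).neg) (fun y hy => neg_le_neg (hM y hy)) y hy
  simpa using this

lemma harmonicExtension_spec {D : Set ℂ} (hreg : DirichletRegular D) {g : ℂ → ℝ}
    (hg : ContinuousOn g (frontier D)) : IsHarmonicExtension D g (harmonicExtension D g) := by
  have h := hreg g hg
  rw [harmonicExtension, dif_pos h]
  exact h.choose_spec

/-- By this uniqueness, the arbitrary choice in `harmonicExtension` is immaterial on the closure of
D. -/
lemma IsHarmonicExtension.eqOn {D : Set ℂ} {g g' u v : ℂ → ℝ} (hD : IsOpen D)
    (hb : Bornology.IsBounded D) (hu : IsHarmonicExtension D g u)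
    (hv : IsHarmonicExtension D g' v) (hgg : EqOn g g' (frontier D)) : EqOn u v (closure D) := by
  have hc := hu.continuousOn.sub hv.continuousOn
  have hh := hu.harmonic.sub hv.harmonic
  have hz : ∀ y ∈ frontier D, (u - v) y = 0 := fun y hy => by
    simp [hu.boundary y hy, hv.boundary y hy, hgg hy]
  intro y hy
  have h1 := HarmonicOnNhd.le_of_frontier_le hD hb hc hh (fun y hy => (hz y hy).le) y hy
  have h2 := HarmonicOnNhd.ge_of_frontier_ge hD hb hc hh (fun y hy => (hz y hy).ge) y hy
  simp only [Pi.sub_apply] at h1 h2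
  linarith

lemma continuous_log_max {ε : ℝ} (hε : 0 < ε) (x : ℂ) :
    Continuous fun w : ℂ => Real.log (max ε ‖x - w‖) :=
  Continuous.log (by fun_prop) fun w => (lt_max_of_lt_left hε).ne'

lemma harmonicAt_log_norm_sub {x y : ℂ} (h : x ≠ y) :
    HarmonicAt (fun w : ℂ => Real.log ‖x - w‖) y :=
  AnalyticAt.harmonicAt_log_norm (f := fun w => x - w) (by fun_prop) (sub_ne_zero.2 h)

/-! ### Pointwise bounds for the regularized Green's function -/

section Green

variable {D : Set ℂ} {ε : ℝ} {x : ℂ}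

/-- The harmonic part of the regularized Green's function. -/
lemma harmonicPart_spec (hreg : DirichletRegular D) (hε : 0 < ε) (x : ℂ) :
    IsHarmonicExtension D (fun w => Real.log (max ε ‖x - w‖))
      (harmonicExtension D (fun w => Real.log (max ε ‖x - w‖))) :=
  harmonicExtension_spec hreg (continuous_log_max hε x).continuousOn

lemma continuousOn_regularizedGreen (hreg : DirichletRegular D) (hε : 0 < ε) (x : ℂ) :
    ContinuousOn (regularizedGreen D ε x) (closure D) :=
  (continuous_log_max hε x).neg.continuousOn.add (harmonicPart_spec hreg hε x).continuousOn

lemma regularizedGreen_frontier (hreg : DirichletRegular D) (hε : 0 < ε) (x : ℂ) :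
    ∀ y ∈ frontier D, regularizedGreen D ε x y = 0 := fun y hy => by
  rw [regularizedGreen, (harmonicPart_spec hreg hε x).boundary y hy]
  ring

/-- In the disc |x - y| ≤ ε, the harmonic part is at least log ε because its boundary data are.
Outside it the whole function is harmonic, with nonnegative values on the circle and zero on ∂D, so
the minimum principle applies. -/
lemma regularizedGreen_nonneg (hD : IsOpen D) (hb : Bornology.IsBounded D)
    (hreg : DirichletRegular D) (hε : 0 < ε) (x : ℂ) :
    ∀ y ∈ closure D, 0 ≤ regularizedGreen D ε x y := by
  have hu := harmonicPart_spec hreg hε x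
  have hcG := continuousOn_regularizedGreen hreg hε x
  have h1 : ∀ y ∈ closure D, Real.log ε ≤
      harmonicExtension D (fun w => Real.log (max ε ‖x - w‖)) y :=
    HarmonicOnNhd.ge_of_frontier_ge hD hb hu.continuousOn hu.harmonic fun y hy => by
      rw [hu.boundary y hy]
      exact Real.log_le_log hε (le_max_left _ _)
  have h2 : ∀ y ∈ closure D, ‖x - y‖ ≤ ε → 0 ≤ regularizedGreen D ε x y := by
    intro y hy hxy
    rw [regularizedGreen, max_eq_left hxy]
    linarith [h1 y hy]
  set U : Set ℂ := D ∩ {w | ε < ‖x - w‖} with hUdef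
  have hUo : IsOpen U := hD.inter (isOpen_lt continuous_const (by fun_prop))
  have hUD : closure U ⊆ closure D := closure_mono inter_subset_left
  have h3 : ∀ y ∈ closure U, 0 ≤ regularizedGreen D ε x y := by
    refine HarmonicOnNhd.ge_of_frontier_ge hUo (hb.subset inter_subset_left) (hcG.mono hUD)
      ?_ ?_
    · intro y hy
      have hxy : x ≠ y := by
        rintro rfl
        have := hy.2
        simp only [mem_ofPred_eq, sub_self, norm_zero] at this
        linarith
      have e : regularizedGreen D ε x =ᶠ[𝓝 y] (fun w => -Real.log ‖x - w‖) +
          harmonicExtension D (fun w => Real.log (max ε ‖x - w‖)) := by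
        filter_upwards [hUo.mem_nhds hy] with w hw
        rw [regularizedGreen, max_eq_right hw.2.le]
        rfl
      rw [harmonicAt_congr_nhds e]
      exact (harmonicAt_log_norm_sub hxy).neg.add (hu.harmonic y hy.1)
    · intro y hy
      have hyD : y ∈ closure D := hUD (frontier_subset_closure hy)
      by_cases hxy : ‖x - y‖ ≤ ε
      · exact h2 y hyD hxy
      · have : y ∈ frontier D := by
          rw [frontier, hD.interior_eq]
          refine ⟨hyD, fun h => ?_⟩
          rw [frontier, hUo.interior_eq] at hy
          exact hy.2 ⟨h, not_le.1 hxy⟩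
        exact (regularizedGreen_frontier hreg hε x y this).ge
  intro y hy
  by_cases hxy : ‖x - y‖ ≤ ε
  · exact h2 y hy hxy
  · rw [closure_eq_self_union_frontier] at hy
    rcases hy with hy | hy
    · exact h3 y (subset_closure ⟨hy, not_le.1 hxy⟩)
    · exact (regularizedGreen_frontier hreg hε x y hy).ge

lemma regularizedGreen_le (hD : IsOpen D) (hb : Bornology.IsBounded D)
    (hreg : DirichletRegular D) (hε : 0 < ε) {R : ℝ} (hεR : ε ≤ R)
    (hR : ∀ y ∈ closure D, ‖x - y‖ ≤ R) :
    ∀ y ∈ closure D, regularizedGreen D ε x y ≤ Real.log R - Real.log (max ε ‖x - y‖) := by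
  have hu := harmonicPart_spec hreg hε x
  intro y hy
  have := HarmonicOnNhd.le_of_frontier_le hD hb hu.continuousOn hu.harmonic
    (M := Real.log R) (fun y hy => by
      rw [hu.boundary y hy]
      exact Real.log_le_log (lt_max_of_lt_left hε)
        (max_le hεR (hR y (frontier_subset_closure hy)))) y hy
  rw [regularizedGreen]
  linarith

lemma not_mem_frontier_of_closedBall (hD : IsOpen D) (h : Metric.closedBall x ε ⊆ D) :
    ∀ y ∈ frontier D, ε < ‖x - y‖ := by
  intro y hy
  by_contra! hlt
  rw [frontier, hD.interior_eq] at hy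
  exact hy.2 (h (by rwa [Metric.mem_closedBall, dist_comm, dist_eq_norm]))

lemma greenCorrection_spec (hreg : DirichletRegular D) (hD : IsOpen D) (hx : x ∈ D) :
    IsHarmonicExtension D (fun w => Real.log ‖x - w‖) (greenCorrection D x) := by
  refine harmonicExtension_spec hreg (ContinuousOn.log (by fun_prop) fun w hw => ?_)
  rw [norm_ne_zero_iff, sub_ne_zero]
  rintro rfl
  rw [frontier, hD.interior_eq] at hw
  exact hw.2 hx

/-- The cutoff at ε is invisible on ∂D once the closed disc lies in D, so both extensions have the
same boundary data. -/
lemma harmonicPart_eq_greenCorrection (hD : IsOpen D) (hb : Bornology.IsBounded D)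
    (hreg : DirichletRegular D) (hε : 0 < ε) (h : Metric.closedBall x ε ⊆ D) :
    EqOn (harmonicExtension D (fun w => Real.log (max ε ‖x - w‖))) (greenCorrection D x)
      (closure D) :=
  (harmonicPart_spec hreg hε x).eqOn hD hb
    (greenCorrection_spec hreg hD (h (Metric.mem_closedBall_self hε.le))) fun y hy => by
      rw [max_eq_right (not_mem_frontier_of_closedBall hD h y hy).le]

end Green

/-! ### Conformal radius and the Green's function at its pole -/

section ConformalRadius

variable {D : Set ℂ} {x : ℂ} {φ : ℂ → ℂ}

/-- The inverse of a conformal map onto the disc is continuous. -/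
lemma IsConformalMapToDisc.continuousOn_invFunOn (hD : IsOpen D) (hDc : IsConnected D)
    (hφ : IsConformalMapToDisc D x φ) :
    ContinuousOn (Function.invFunOn φ D) (Metric.ball 0 1) := by
  have hinv : InvOn (Function.invFunOn φ D) φ D (Metric.ball 0 1) := hφ.bijOn.invOn_invFunOn
  have hmaps : MapsTo (Function.invFunOn φ D) (Metric.ball 0 1) D :=
    hφ.bijOn.surjOn.mapsTo_invFunOn
  rw [continuousOn_open_iff Metric.isOpen_ball]
  intro t ht
  have hopen : ∀ s ⊆ D, IsOpen s → IsOpen (φ '' s) := by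
    rcases (hφ.differentiableOn.analyticOnNhd hD).is_constant_or_isOpen hDc.isPreconnected with
      ⟨w, hw⟩ | h
    · exfalso
      obtain ⟨a, ha, h0⟩ := hφ.bijOn.surjOn (show (0 : ℂ) ∈ Metric.ball 0 1 by simp)
      obtain ⟨b, hb, h1⟩ := hφ.bijOn.surjOn (show (1 / 2 : ℂ) ∈ Metric.ball 0 1 by
        simp; norm_num)
      rw [hw a ha] at h0
      rw [hw b hb, h0] at h1
      norm_num at h1
    · exact h
  have : Metric.ball 0 1 ∩ Function.invFunOn φ D ⁻¹' t = φ '' (D ∩ t) := by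
    ext w
    constructor
    · rintro ⟨hw, hwt⟩
      exact ⟨_, ⟨hmaps hw, hwt⟩, hinv.2 hw⟩
    · rintro ⟨y, ⟨hy, hyt⟩, rfl⟩
      refine ⟨hφ.bijOn.mapsTo hy, ?_⟩
      rw [mem_preimage, hinv.1 hy]
      exact hyt
  rw [this]
  exact hopen _ inter_subset_left (hD.inter ht)

/-- Zeros of φ' are isolated, since φ is injective. So the continuous inverse is differentiable near
0 except perhaps at 0; that singularity is removable, and the chain rule at 0 gives φ'(x) · ψ'(0) =
1. -/
lemma IsConformalMapToDisc.deriv_ne_zero (hD : IsOpen D) (hDc : IsConnected D) (hx : x ∈ D)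
    (hφ : IsConformalMapToDisc D x φ) : deriv φ x ≠ 0 := by
  have hinv : InvOn (Function.invFunOn φ D) φ D (Metric.ball 0 1) := hφ.bijOn.invOn_invFunOn
  have hmaps : MapsTo (Function.invFunOn φ D) (Metric.ball 0 1) D :=
    hφ.bijOn.surjOn.mapsTo_invFunOn
  have hcont := hφ.continuousOn_invFunOn hD hDc
  set ψ := Function.invFunOn φ D with hψ
  have hψ0 : ψ 0 = x := by
    have := hinv.1 hx
    rwa [hφ.map_center] at this
  have hball : ∀ w ∈ Metric.ball (0 : ℂ) 1, Metric.ball (0 : ℂ) 1 ∈ 𝓝 w := fun w hw =>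
    Metric.isOpen_ball.mem_nhds hw
  have h0 : (0 : ℂ) ∈ Metric.ball (0 : ℂ) 1 := by simp
  have hψc : ContinuousAt ψ 0 := hcont.continuousAt (hball 0 h0)
  have hana := hφ.differentiableOn.analyticOnNhd hD
  have hder : ∀ᶠ z in 𝓝[≠] x, deriv φ z ≠ 0 := by
    rcases (hana.deriv x hx).eventually_eq_zero_or_eventually_ne_zero with h | h
    · exfalso
      obtain ⟨r, hr, hsub⟩ := Metric.mem_nhds_iff.1 (h.and (hD.mem_nhds hx))
      have hpre : IsPreconnected (Metric.ball x r) := (convex_ball x r).isPreconnected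
      have hy : x + (r / 2 : ℝ) ∈ Metric.ball x r := by
        rw [Metric.mem_ball, dist_eq_norm, add_sub_cancel_left, Complex.norm_real,
          Real.norm_eq_abs, abs_of_pos (by positivity)]
        linarith
      have hxr : x ∈ Metric.ball x r := Metric.mem_ball_self hr
      have := Metric.isOpen_ball.is_const_of_deriv_eq_zero hpre
        (hφ.differentiableOn.mono fun z hz => (hsub hz).2) (fun z hz => (hsub hz).1) hxr hy
      have := hφ.bijOn.injOn hx (hsub hy).2 this
      rw [left_eq_add, Complex.ofReal_eq_zero] at this
      linarith
    · exact h
  have hdiff : ∀ᶠ w in 𝓝[≠] (0 : ℂ), DifferentiableAt ℂ ψ w := by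
    have ht : Tendsto ψ (𝓝[≠] (0 : ℂ)) (𝓝[≠] x) := by
      refine tendsto_nhdsWithin_iff.2 ⟨hψ0 ▸ hψc.tendsto.mono_left nhdsWithin_le_nhds, ?_⟩
      filter_upwards [self_mem_nhdsWithin, mem_nhdsWithin_of_mem_nhds (hball 0 h0)] with w hw hwb
      intro (h : ψ w = x)
      have := hinv.2 hwb
      rw [h, hφ.map_center] at this
      exact hw this.symm
    filter_upwards [ht.eventually hder, mem_nhdsWithin_of_mem_nhds (hball 0 h0)] with w hw hwb
    exact (HasDerivAt.of_local_left_inverse (hcont.continuousAt (hball w hwb))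
      (hana _ (hmaps hwb)).differentiableAt.hasDerivAt hw
      (by filter_upwards [hball w hwb] with z hz using hinv.2 hz)).differentiableAt
  have hψd : DifferentiableAt ℂ ψ 0 :=
    (Complex.analyticAt_of_differentiable_on_punctured_nhds_of_continuousAt hdiff
      hψc).differentiableAt
  have hφd : HasDerivAt φ (deriv φ x) (ψ 0) := hψ0.symm ▸ (hana x hx).differentiableAt.hasDerivAt
  have hcomp := hφd.comp (0 : ℂ) hψd.hasDerivAt
  have hid : HasDerivAt (φ ∘ ψ) 1 0 := (hasDerivAt_id (0 : ℂ)).congr_of_eventuallyEq (by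
    filter_upwards [hball 0 h0] with z hz using hinv.2 hz)
  intro h
  have := hcomp.unique hid
  rw [h, zero_mul] at this
  exact zero_ne_one this

/-- Properness: the preimage of a closed disc of radius r < 1 is a compact subset of D, hence stays
away from y. -/
lemma IsConformalMapToDisc.tendsto_norm (hD : IsOpen D) (hDc : IsConnected D)
    (hφ : IsConformalMapToDisc D x φ) {y : ℂ} (hy : y ∉ D) :
    Tendsto (fun z => ‖φ z‖) (𝓝[D] y) (𝓝 1) := by
  have hinv : InvOn (Function.invFunOn φ D) φ D (Metric.ball 0 1) := hφ.bijOn.invOn_invFunOn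
  have hmaps : MapsTo (Function.invFunOn φ D) (Metric.ball 0 1) D :=
    hφ.bijOn.surjOn.mapsTo_invFunOn
  refine tendsto_order.2 ⟨fun r hr => ?_, fun r hr => ?_⟩
  · have hsub : Metric.closedBall (0 : ℂ) r ⊆ Metric.ball 0 1 := Metric.closedBall_subset_ball hr
    have hK : IsCompact (Function.invFunOn φ D '' Metric.closedBall 0 r) :=
      (isCompact_closedBall 0 r).image_of_continuousOn
        ((hφ.continuousOn_invFunOn hD hDc).mono hsub)
    have hyK : y ∉ Function.invFunOn φ D '' Metric.closedBall 0 r := by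
      rintro ⟨w, hw, rfl⟩
      exact hy (hmaps (hsub hw))
    filter_upwards [self_mem_nhdsWithin,
      mem_nhdsWithin_of_mem_nhds (hK.isClosed.isOpen_compl.mem_nhds hyK)] with z hz hzK
    by_contra! hle
    exact hzK ⟨φ z, by simpa using hle, hinv.1 hz⟩
  · filter_upwards [self_mem_nhdsWithin] with z hz
    have := hφ.bijOn.mapsTo hz
    rw [mem_ball_zero_iff] at this
    linarith

/-- The conformal radius is the exponential of the harmonic correction at its pole. -/
theorem conformalRadius_eq_exp (hD : IsOpen D) (hDc : IsConnected D)
    (hb : Bornology.IsBounded D) (hreg : DirichletRegular D) (hx : x ∈ D) :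
    conformalRadius D x = Real.exp (greenCorrection D x x) := by
  rw [conformalRadius]
  split_ifs with h
  swap
  · rfl
  have hφ := h.choose_spec
  set φ := h.choose
  have hg := greenCorrection_spec hreg hD hx
  have hana := hφ.differentiableOn.analyticOnNhd hD
  have hds : DifferentiableOn ℂ (dslope φ x) D :=
    (Complex.differentiableOn_dslope (hD.mem_nhds hx)).2 hφ.differentiableOn
  have hds_of_ne : ∀ y, y ≠ x → dslope φ x y = (y - x)⁻¹ * φ y := fun y hy => by
    rw [dslope_of_ne _ hy, slope_def_field, hφ.map_center, sub_zero, div_eq_inv_mul]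
  have hds0 : ∀ y ∈ D, dslope φ x y ≠ 0 := by
    intro y hy
    by_cases hyx : y = x
    · rw [hyx, dslope_same]
      exact hφ.deriv_ne_zero hD hDc hx
    · rw [hds_of_ne y hyx]
      refine mul_ne_zero (inv_ne_zero (sub_ne_zero.2 hyx)) fun h0 => hyx ?_
      exact hφ.bijOn.injOn hy hx (h0.trans hφ.map_center.symm)
  -- Away from x, w = log|φ| - log|x - ·| + G̃^x, that is, log|φ| + G_D(x, ·). Dividing out the zero
  -- of φ makes w harmonic at x too. Its boundary values are 0, so w = 0, and evaluation at x gives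
  -- log|φ'(x)| + G̃^x(x) = 0.
  set w : ℂ → ℝ := fun y => Real.log ‖dslope φ x y‖ + greenCorrection D x y with hw
  have hwh : HarmonicOnNhd w D := fun y hy =>
    (AnalyticAt.harmonicAt_log_norm (hds.analyticOnNhd hD y hy) (hds0 y hy)).add
      (hg.harmonic y hy)
  have hlim : ∀ y ∈ frontier D, Tendsto w (𝓝[D] y) (𝓝 0) := by
    intro y hy
    have hyD : y ∉ D := fun h => by
      rw [frontier, hD.interior_eq] at hy
      exact hy.2 h
    have hxy : x ≠ y := by rintro rfl; exact hyD hx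
    have h1 : Tendsto (fun z => Real.log ‖φ z‖) (𝓝[D] y) (𝓝 0) := by
      rw [← Real.log_one]
      exact (hφ.tendsto_norm hD hDc hyD).log one_ne_zero
    have h2 : Tendsto (fun z => Real.log ‖x - z‖) (𝓝[D] y) (𝓝 (Real.log ‖x - y‖)) := by
      refine Tendsto.log ?_ (norm_ne_zero_iff.2 (sub_ne_zero.2 hxy))
      exact ((by fun_prop : Continuous fun z => ‖x - z‖).tendsto y).mono_left nhdsWithin_le_nhds
    have h3 : Tendsto (greenCorrection D x) (𝓝[D] y) (𝓝 (Real.log ‖x - y‖)) := by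
      have := hg.continuousOn y (frontier_subset_closure hy)
      rw [ContinuousWithinAt, hg.boundary y hy] at this
      exact this.mono_left (nhdsWithin_mono _ subset_closure)
    have h4 := (h1.sub h2).add h3
    rw [zero_sub, neg_add_cancel] at h4
    refine h4.congr' ?_
    filter_upwards [self_mem_nhdsWithin, mem_nhdsWithin_of_mem_nhds
      (isOpen_ne.mem_nhds hxy.symm)] with z hz hzx
    have hφz : φ z ≠ 0 := fun h0 =>
      hzx (hφ.bijOn.injOn hz hx (h0.trans hφ.map_center.symm))
    simp only [hw]
    rw [hds_of_ne z hzx, norm_mul, norm_inv, Real.log_mul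
      (inv_ne_zero (norm_ne_zero_iff.2 (sub_ne_zero.2 hzx))) (norm_ne_zero_iff.2 hφz),
      Real.log_inv, norm_sub_rev z x]
    ring
  have hW : IsHarmonicExtension D 0 (D.indicator w) := by
    refine ⟨fun y hy => ?_, fun y hy => ?_, fun y hy => ?_⟩
    · by_cases hyD : y ∈ D
      · refine ContinuousAt.continuousWithinAt ?_
        have hc : ContinuousAt w y := (hwh y hyD).1.continuousAt
        exact hc.congr (by filter_upwards [hD.mem_nhds hyD] with z hz; rw [indicator_of_mem hz])
      · have hyF : y ∈ frontier D := by
          rw [frontier, hD.interior_eq]; exact ⟨hy, hyD⟩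
        refine ContinuousAt.continuousWithinAt ?_
        rw [ContinuousAt, indicator_of_notMem hyD, ← nhdsWithin_univ, ← union_compl_self D,
          nhdsWithin_union]
        refine Tendsto.sup ((hlim y hyF).congr' ?_) (tendsto_const_nhds.congr' ?_)
        · filter_upwards [self_mem_nhdsWithin] with z hz; rw [indicator_of_mem hz]
        · filter_upwards [self_mem_nhdsWithin] with z hz; rw [indicator_of_notMem hz]
    · rw [harmonicAt_congr_nhds (f₂ := w)]
      · exact hwh y hy
      · filter_upwards [hD.mem_nhds hy] with z hz; rw [indicator_of_mem hz]
    · rw [indicator_of_notMem]; · rfl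
      rw [frontier, hD.interior_eq] at hy; exact hy.2
  have h0 : IsHarmonicExtension D 0 (0 : ℂ → ℝ) :=
    ⟨continuousOn_const, fun y _ => harmonicAt_const 0, fun _ _ => rfl⟩
  have := hW.eqOn hD hb h0 (fun _ _ => rfl) (subset_closure hx)
  rw [indicator_of_mem hx, hw] at this
  simp only [dslope_same, Pi.zero_apply] at this
  have hpos : 0 < ‖deriv φ x‖ := norm_pos_iff.2 (hφ.deriv_ne_zero hD hDc hx)
  rw [show greenCorrection D x x = -Real.log ‖deriv φ x‖ by linarith, Real.exp_neg,
    Real.exp_log hpos]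

end ConformalRadius

/-! ### Dirichlet integrals against harmonic functions and truncated logarithms -/

lemma inner_gradient_gradient (f g : ℂ → ℝ) (y : ℂ) :
    (inner ℝ (∇ f y) (∇ g y) : ℝ) =
      fderiv ℝ f y 1 * fderiv ℝ g y 1 + fderiv ℝ f y Complex.I * fderiv ℝ g y Complex.I := by
  have h : ∀ (f : ℂ → ℝ) v, fderiv ℝ f y v = inner ℝ (∇ f y) v := fun f v => by
    rw [gradient, toDual_symm_apply]
  simp only [h, Complex.inner]
  simp
  ring

lemma inner_gradient_eq_fderiv (f : ℂ → ℝ) (y v : ℂ) :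
    (inner ℝ (∇ f y) v : ℝ) = fderiv ℝ f y v := by
  rw [gradient, toDual_symm_apply]

lemma norm_gradient (f : ℂ → ℝ) (y : ℂ) : ‖∇ f y‖ = ‖fderiv ℝ f y‖ := by
  rw [gradient, LinearIsometryEquiv.norm_map]

lemma measurable_gradient (f : ℂ → ℝ) : Measurable (∇ f) :=
  (toDual ℝ ℂ).symm.continuous.measurable.comp (measurable_fderiv ℝ f)

lemma HasCompactSupport.integrable_mul_of_continuousAt {f F : ℂ → ℝ} (hf : Continuous f)
    (hc : HasCompactSupport f) (hF : ∀ x ∈ tsupport f, ContinuousAt F x) :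
    Integrable (fun x => f x * F x) := by
  refine Continuous.integrable_of_hasCompactSupport ?_ hc.mul_right
  refine continuous_of_tsupport fun x hx => ?_
  exact hf.continuousAt.mul (hF x (tsupport_mul_subset_left hx))

/-- The Dirichlet inner product of a test function and a harmonic function vanishes. -/
lemma integral_inner_gradient_harmonic {D : Set ℂ} {f u : ℂ → ℝ} (hf : IsTestFunction D f)
    (hu : HarmonicOnNhd u D) :
    Integrable (fun y => (inner ℝ (∇ f y) (∇ u y) : ℝ)) ∧
      ∫ y, (inner ℝ (∇ f y) (∇ u y) : ℝ) = 0 := by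
  have hu1 : ∀ y ∈ tsupport f, ContDiffAt ℝ 1 (fderiv ℝ u) y := fun y hy =>
    (hu y (hf.support hy)).1.fderiv_right (by norm_num)
  have hdiff : ∀ v, ∀ y ∈ tsupport f, HasFDerivAt (fun z => fderiv ℝ u z v)
      ((fderiv ℝ (fderiv ℝ u) y).flip v) y := fun v y hy => by
    have := ((hu1 y hy).differentiableAt one_ne_zero).hasFDerivAt.clm_apply
      (hasFDerivAt_const v y)
    simpa using this
  have hcont2 : ∀ v, ∀ y ∈ tsupport f,
      ContinuousAt (fun z => fderiv ℝ (fun z => fderiv ℝ u z v) z v) y := fun v y hy => by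
    have h1 : ContDiffAt ℝ 1 (fun z => fderiv ℝ u z v) y := (hu1 y hy).clm_apply contDiffAt_const
    exact ((h1.fderiv_right (m := 0) (by norm_num)).clm_apply
      (contDiffAt_const (c := v))).continuousAt
  have hcont1 : ∀ v, ∀ y ∈ tsupport f, ContinuousAt (fun z => fderiv ℝ u z v) y :=
    fun v y hy => (hdiff v y hy).continuousAt
  have hfd : ∀ v, Continuous fun y => fderiv ℝ f y v := fun v =>
    (hf.smooth.continuous_fderiv (by simp)).clm_apply continuous_const
  have hfs : ∀ v, HasCompactSupport fun y => fderiv ℝ f y v := fun v =>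
    hf.compact.fderiv_apply (𝕜 := ℝ) v
  have hfts : ∀ v, tsupport (fun y => fderiv ℝ f y v) ⊆ tsupport f := fun v =>
    tsupport_fderiv_apply_subset ℝ v
  have hint1 : ∀ v, Integrable (fun y => fderiv ℝ f y v * fderiv ℝ u y v) := fun v =>
    (hfs v).integrable_mul_of_continuousAt (hfd v) fun y hy => hcont1 v y (hfts v hy)
  have hint2 : ∀ v, Integrable (fun y => f y * fderiv ℝ (fun z => fderiv ℝ u z v) y v) := fun v =>
    hf.compact.integrable_mul_of_continuousAt hf.smooth.continuous (hcont2 v)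
  -- Integration by parts in each coordinate direction moves both derivatives onto u; their sum
  -- contains the Laplacian, which vanishes on the support of f.
  have hibp : ∀ v, ∫ y, f y * fderiv ℝ (fun z => fderiv ℝ u z v) y v =
      - ∫ y, fderiv ℝ f y v * fderiv ℝ u y v := fun v =>
    integral_mul_fderiv_eq_neg_fderiv_mul_of_integrable (hint1 v) (hint2 v)
      (hf.compact.integrable_mul_of_continuousAt hf.smooth.continuous (hcont1 v))
      (fun y _ => hf.smooth.differentiable (by simp) y)
      (fun y hy => (hdiff v y hy).differentiableAt)
  simp only [inner_gradient_gradient]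
  refine ⟨(hint1 1).add (hint1 Complex.I), ?_⟩
  have hlap : ∫ y, (f y * fderiv ℝ (fun z => fderiv ℝ u z 1) y 1 +
      f y * fderiv ℝ (fun z => fderiv ℝ u z Complex.I) y Complex.I) = 0 := by
    refine integral_eq_zero_of_ae (Eventually.of_forall fun y => ?_)
    by_cases hy : y ∈ tsupport f
    · have h := (hu y (hf.support hy)).2.self_of_nhds
      rw [laplacian_eq_iteratedFDeriv_complexPlane] at h
      simp only [iteratedFDeriv_two_apply] at h
      simp only [(hdiff _ y hy).fderiv, ContinuousLinearMap.flip_apply, ← mul_add]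
      simp at h
      simp [h]
    · simp [image_eq_zero_of_notMem_tsupport hy]
  rw [integral_add (hint2 1) (hint2 _), hibp, hibp] at hlap
  rw [integral_add (hint1 1) (hint1 _)]
  linarith

section LogMax

variable {ε : ℝ}

/-- From log(s/t) ≤ s/t - 1 and t ≥ ε. -/
lemma lipschitzWith_log_max (hε : 0 < ε) (x : ℂ) :
    LipschitzWith (Real.toNNReal ε⁻¹) fun w : ℂ => Real.log (max ε ‖x - w‖) := by
  refine LipschitzWith.of_le_add_mul _ fun a b => ?_
  have ha : 0 < max ε ‖x - a‖ := lt_max_of_lt_left hε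
  have hb : 0 < max ε ‖x - b‖ := lt_max_of_lt_left hε
  have h1 : Real.log (max ε ‖x - a‖) - Real.log (max ε ‖x - b‖) ≤
      max ε ‖x - a‖ / max ε ‖x - b‖ - 1 := by
    rw [← Real.log_div ha.ne' hb.ne']
    exact Real.log_le_sub_one_of_pos (div_pos ha hb)
  have h2 : max ε ‖x - a‖ ≤ max ε ‖x - b‖ + dist a b := by
    refine max_le (le_add_of_le_of_nonneg (le_max_left _ _) dist_nonneg) ?_
    have : ‖x - a‖ ≤ ‖x - b‖ + ‖b - a‖ := by
      simpa using norm_add_le (x - b) (b - a)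
    rw [dist_comm, dist_eq_norm]
    linarith [le_max_right ε ‖x - b‖]
  have h3 : max ε ‖x - a‖ / max ε ‖x - b‖ - 1 ≤ ε⁻¹ * dist a b := by
    rw [div_sub_one hb.ne', inv_mul_eq_div]
    exact div_le_div₀ dist_nonneg (by linarith) hε (le_max_left _ _)
  rw [Real.coe_toNNReal _ (inv_nonneg.2 hε.le)]
  linarith

lemma gradient_neg_log_max_of_lt {x y : ℂ} (h : ‖x - y‖ < ε) :
    ∇ (fun w : ℂ => -Real.log (max ε ‖x - w‖)) y = 0 := by
  have e : (fun w : ℂ => -Real.log (max ε ‖x - w‖)) =ᶠ[𝓝 y] fun _ => -Real.log ε := by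
    have : {w : ℂ | ‖x - w‖ < ε} ∈ 𝓝 y :=
      (isOpen_lt (by fun_prop) continuous_const).mem_nhds h
    filter_upwards [this] with w hw
    rw [max_eq_left (le_of_lt hw)]
  rw [gradient, e.fderiv_eq]
  simp

lemma hasGradientAt_neg_log_max {x y : ℂ} (hε : 0 < ε) (h : ε < ‖x - y‖) :
    HasGradientAt (fun w : ℂ => -Real.log (max ε ‖x - w‖)) (-(‖y - x‖ ^ 2)⁻¹ • (y - x)) y := by
  have e : (fun w : ℂ => -Real.log (max ε ‖x - w‖)) =ᶠ[𝓝 y]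
      fun w => -(1 / 2) * Real.log (‖w - x‖ ^ 2) := by
    have : {w : ℂ | ε < ‖x - w‖} ∈ 𝓝 y :=
      (isOpen_lt continuous_const (by fun_prop)).mem_nhds h
    filter_upwards [this] with w hw
    rw [max_eq_right (le_of_lt hw), Real.log_pow, norm_sub_rev]
    push_cast
    ring
  have hpos : ‖y - x‖ ^ 2 ≠ 0 := by
    rw [norm_sub_rev]
    have : 0 < ‖x - y‖ := hε.trans h
    positivity
  have h1 := ((hasFDerivAt_id (𝕜 := ℝ) y).sub_const x).norm_sq
  have h2 := ((h1.log hpos).const_mul (-(1 / 2))).congr_of_eventuallyEq e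
  rw [hasGradientAt_iff_hasFDerivAt]
  refine h2.congr_fderiv (ContinuousLinearMap.ext fun v => ?_)
  rw [toDual_apply_apply, real_inner_smul_left]
  simp [inner_sub_left]
  ring

end LogMax

lemma integral_Ioi_fderiv_ray {f : ℂ → ℝ} (hf : ContDiff ℝ 1 f) (hc : HasCompactSupport f)
    (x : ℂ) {v : ℂ} (hv : ‖v‖ = 1) (ε : ℝ) :
    ∫ r in Ioi ε, fderiv ℝ f (x + (r : ℂ) * v) v = - f (x + (ε : ℂ) * v) := by
  have hd : ∀ r : ℝ, HasDerivAt (fun r : ℝ => x + (r : ℂ) * v) v r := fun r => by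
    simpa using ((Complex.ofRealCLM.hasDerivAt (x := r)).mul_const v).const_add x
  have hg : ContDiff ℝ 1 (fun r : ℝ => f (x + (r : ℂ) * v)) :=
    hf.comp (contDiff_const.add (Complex.ofRealCLM.contDiff.mul contDiff_const))
  have hgc : HasCompactSupport (fun r : ℝ => f (x + (r : ℂ) * v)) := by
    obtain ⟨R, hR⟩ := hc.isCompact.isBounded.exists_norm_le
    refine HasCompactSupport.intro (isCompact_Icc (a := -(R + ‖x‖)) (b := R + ‖x‖)) fun r hr => ?_
    by_contra hne
    have h1 := hR _ (subset_tsupport _ hne)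
    have h2 : |r| ≤ ‖x + (r : ℂ) * v‖ + ‖x‖ := by
      have : ‖(r : ℂ) * v‖ ≤ ‖x + (r : ℂ) * v‖ + ‖x‖ := by
        simpa using norm_sub_le (x + (r : ℂ) * v) x
      simpa [hv] using this
    exact hr (abs_le.1 (by linarith))
  have := hgc.integral_Ioi_deriv_eq hg ε
  rw [← this]
  refine integral_congr_ae (Eventually.of_forall fun r => ?_)
  exact (((hf.differentiable one_ne_zero _).hasFDerivAt.comp_hasDerivAt r (hd r)).deriv).symm

/-- `-Δ log (1 / max ε |x - ·|) / (2π)` is the uniform measure on the circle. -/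
lemma integral_inner_gradient_neg_log_max {f : ℂ → ℝ} (hf : ContDiff ℝ 1 f)
    (hc : HasCompactSupport f) (x : ℂ) {ε : ℝ} (hε : 0 < ε) :
    ∫ y, (inner ℝ (∇ f y) (∇ (fun w : ℂ => -Real.log (max ε ‖x - w‖)) y) : ℝ) =
      2 * π * circleAverage f x ε := by
  rw [← integral_add_left_eq_self _ x, ← Complex.integral_comp_polarCoord_symm]
  set k : ℝ × ℝ → ℝ := fun p =>
    -fderiv ℝ f (x + (p.1 : ℂ) * (Real.cos p.2 + Real.sin p.2 * Complex.I))
      (Real.cos p.2 + Real.sin p.2 * Complex.I) with hk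
  have hnorm : ∀ θ : ℝ, ‖(Real.cos θ + Real.sin θ * Complex.I : ℂ)‖ = 1 := fun θ => by
    rw [Complex.ofReal_cos, Complex.ofReal_sin, ← Complex.exp_mul_I, Complex.norm_exp_ofReal_mul_I]
  have hkc : Continuous k := by
    refine Continuous.neg (Continuous.clm_apply ?_ (by fun_prop))
    exact (hf.continuous_fderiv one_ne_zero).comp (by fun_prop)
  -- The Jacobian r cancels the length 1/r of the gradient, leaving minus the radial derivative of f
  -- on r > ε and zero on r < ε. The circle r = ε, where the cutoff has its kink, is a null set.
  have h1 : ∫ p in polarCoord.target, p.1 • (inner ℝ (∇ f (x + Complex.polarCoord.symm p))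
      (∇ (fun w : ℂ => -Real.log (max ε ‖x - w‖)) (x + Complex.polarCoord.symm p)) : ℝ) =
      ∫ p in polarCoord.target, (Ioi ε ×ˢ univ).indicator k p := by
    refine setIntegral_congr_ae (polarCoord.open_target.measurableSet) ?_
    have hnull : ∀ᵐ p : ℝ × ℝ, p.1 ≠ ε := by
      have : {p : ℝ × ℝ | ¬ p.1 ≠ ε} = {ε} ×ˢ univ := by ext p; simp
      rw [ae_iff, this, Measure.volume_eq_prod, Measure.prod_prod]
      simp
    filter_upwards [hnull] with p hp hpt
    have hp0 : 0 < p.1 := hpt.1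
    rw [Complex.polarCoord_symm_apply]
    have hn : ‖x - (x + (p.1 : ℂ) * (Real.cos p.2 + Real.sin p.2 * Complex.I))‖ = p.1 := by
      rw [sub_add_cancel_left, norm_neg, norm_mul, hnorm, Complex.norm_real, Real.norm_eq_abs,
        abs_of_pos hp0, mul_one]
    rcases lt_or_gt_of_ne hp with h | h
    · rw [gradient_neg_log_max_of_lt (by rwa [hn]), indicator_of_notMem]
      · simp
      · simp [h.le]
    · rw [(hasGradientAt_neg_log_max hε (by rwa [hn])).gradient, indicator_of_mem (by simpa using h),
        inner_gradient_eq_fderiv, norm_sub_rev, hn, add_sub_cancel_left]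
      change p.1 • (fderiv ℝ f _) _ = -(fderiv ℝ f _) _
      rw [← map_neg, ← map_smul]
      congr 1
      rw [Complex.real_smul, Complex.real_smul]
      push_cast
      have : (p.1 : ℂ) ≠ 0 := by exact_mod_cast hp0.ne'
      field_simp
  have hint : IntegrableOn k (Ioi ε ×ˢ Ioo (-π) π) := by
    obtain ⟨R, hR⟩ := hc.isCompact.isBounded.exists_norm_le
    have hK : IntegrableOn k (Icc ε (R + ‖x‖) ×ˢ Icc (-π) π) :=
      hkc.continuousOn.integrableOn_compact (isCompact_Icc.prod isCompact_Icc)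
    refine hK.of_forall_sdiff_eq_zero (measurableSet_Ioi.prod measurableSet_Ioo) ?_
    rintro p ⟨⟨hp1, hp2⟩, hp⟩
    have hp3 : R + ‖x‖ < p.1 := by
      by_contra! hle
      exact hp ⟨⟨le_of_lt hp1, hle⟩, Ioo_subset_Icc_self hp2⟩
    have hy : x + (p.1 : ℂ) * (Real.cos p.2 + Real.sin p.2 * Complex.I) ∉ tsupport f := by
      intro hy
      have h1 := hR _ hy
      have h2 : ‖(p.1 : ℂ) * (Real.cos p.2 + Real.sin p.2 * Complex.I)‖ ≤
          ‖x + (p.1 : ℂ) * (Real.cos p.2 + Real.sin p.2 * Complex.I)‖ + ‖x‖ := by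
        simpa using norm_sub_le (x + (p.1 : ℂ) * (Real.cos p.2 + Real.sin p.2 * Complex.I)) x
      rw [norm_mul, hnorm, Complex.norm_real, Real.norm_eq_abs, mul_one] at h2
      linarith [le_abs_self p.1]
    simp only [hk]
    have := image_eq_zero_of_notMem_tsupport
      (fun h => hy (tsupport_fderiv_subset ℝ h))
    rw [this]
    simp
  rw [h1, setIntegral_indicator (measurableSet_Ioi.prod MeasurableSet.univ)]
  have hset : polarCoord.target ∩ Ioi ε ×ˢ univ = Ioi ε ×ˢ Ioo (-π) π := by
    ext p
    simp only [polarCoord_target, mem_inter_iff, mem_prod, mem_Ioi, mem_univ, and_true]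
    constructor
    · rintro ⟨⟨_, h⟩, h'⟩; exact ⟨h', h⟩
    · rintro ⟨h, h'⟩; exact ⟨⟨hε.trans h, h'⟩, h⟩
  rw [hset, Measure.volume_eq_prod, ← Measure.prod_restrict, integral_prod_symm]
  swap
  · rw [Measure.prod_restrict]; exact hint
  have h2 : ∀ θ : ℝ, ∫ r in Ioi ε, k (r, θ) = f (circleMap x ε θ) := by
    intro θ
    simp only [hk]
    rw [integral_neg, integral_Ioi_fderiv_ray hf hc x (hnorm θ) ε, neg_neg, circleMap,
      Complex.exp_mul_I, Complex.ofReal_cos, Complex.ofReal_sin]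
  simp only [h2]
  rw [← integral_Ioc_eq_integral_Ioo, ← intervalIntegral.integral_of_le (by linarith [pi_pos]),
    circleAverage_def, smul_eq_mul, mul_inv_cancel_left₀ (by positivity)]
  have hper : Function.Periodic (fun θ => f (circleMap x ε θ)) (2 * π) := fun θ => by
    simp only [periodic_circleMap x ε θ]
  have := hper.intervalIntegral_add_eq (-π) 0
  rw [zero_add, show -π + 2 * π = π by ring] at this
  exact this

/-! ### Approximation of Lipschitz functions by test functions -/

/-- Dominated convergence in `L²`. -/
lemma tendsto_toLp_two_of_dominated {α E : Type*} [MeasurableSpace α] {μ : Measure α}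
    [NormedAddCommGroup E] [InnerProductSpace ℝ E] {f : ℕ → α → E} {g : α → E} {b : α → ℝ}
    (hf : ∀ n, MemLp (f n) 2 μ) (hg : MemLp g 2 μ) (hb : Integrable (fun a => b a ^ 2) μ)
    (hfb : ∀ n, ∀ᵐ a ∂μ, ‖f n a‖ ≤ b a)
    (hlim : ∀ᵐ a ∂μ, Tendsto (fun n => f n a) atTop (𝓝 (g a))) :
    Tendsto (fun n => (hf n).toLp (f n)) atTop (𝓝 (hg.toLp g)) := by
  rw [tendsto_iff_norm_sub_tendsto_zero]
  have hnorm : ∀ n, ‖(hf n).toLp (f n) - hg.toLp g‖ ^ 2 = ∫ a, ‖f n a - g a‖ ^ 2 ∂μ := by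
    intro n
    rw [← MemLp.toLp_sub, ← real_inner_self_eq_norm_sq, L2.inner_def]
    refine integral_congr_ae ?_
    filter_upwards [((hf n).sub hg).coeFn_toLp] with a ha
    rw [ha, real_inner_self_eq_norm_sq]
    rfl
  have hgb : ∀ᵐ a ∂μ, ‖g a‖ ≤ b a := by
    filter_upwards [ae_all_iff.2 hfb, hlim] with a ha hl
    exact le_of_tendsto hl.norm (Eventually.of_forall ha)
  have h0 : Tendsto (fun n => ∫ a, ‖f n a - g a‖ ^ 2 ∂μ) atTop (𝓝 (∫ _, (0 : ℝ) ∂μ)) := by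
    refine tendsto_integral_of_dominated_convergence (fun a => 4 * b a ^ 2)
      (fun n => ((hf n).1.sub hg.1).norm.pow 2) (hb.const_mul 4) (fun n => ?_) ?_
    · filter_upwards [hfb n, hgb] with a h1 h2
      rw [Real.norm_eq_abs, abs_of_nonneg (by positivity)]
      have h3 : ‖f n a - g a‖ ≤ 2 * b a := (norm_sub_le _ _).trans (by linarith)
      calc ‖f n a - g a‖ ^ 2 ≤ (2 * b a) ^ 2 := pow_le_pow_left₀ (norm_nonneg _) h3 2
        _ = 4 * b a ^ 2 := by ring
    · filter_upwards [hlim] with a ha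
      have := ((ha.sub_const (g a)).norm.pow 2)
      simpa using this
  simp only [integral_zero] at h0
  have h1 := h0.sqrt
  rw [Real.sqrt_zero] at h1
  refine h1.congr fun n => ?_
  rw [← hnorm, Real.sqrt_sq (norm_nonneg _)]

/-- A Lipschitz function with compact support in `D` is a limit of test functions on `D`. -/
lemma LipschitzWith.exists_isTestFunction_tendsto {D : Set ℂ} {g : ℂ → ℝ} {C : ℝ≥0} (hD : IsOpen D)
    (hg : LipschitzWith C g) (hc : HasCompactSupport g) (hs : tsupport g ⊆ D) :
    ∃ K, IsCompact K ∧ K ⊆ D ∧ ∃ f : ℕ → ℂ → ℝ, (∀ n, IsTestFunction D (f n)) ∧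
      (∀ n, tsupport (f n) ⊆ K) ∧ (∀ y, Tendsto (fun n => f n y) atTop (𝓝 (g y))) ∧
      (∀ n y, |f n y - g y| ≤ C) ∧
      (∀ n y, ‖fderiv ℝ (f n) y‖ ≤ C) ∧
      ∀ᵐ y, Tendsto (fun n => fderiv ℝ (f n) y) atTop (𝓝 (fderiv ℝ g y)) := by
  obtain ⟨δ₀, hδ₀, hsub₀⟩ := hc.isCompact.exists_cthickening_subset_open hD hs
  -- A mollification radius of at most 1 makes the uniform error at most the Lipschitz constant C.
  obtain ⟨δ, hδ, hδ1, hsub⟩ : ∃ δ > 0, δ ≤ 1 ∧ Metric.cthickening δ (tsupport g) ⊆ D :=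
    ⟨min δ₀ 1, by positivity, min_le_right _ _,
      (Metric.cthickening_mono (min_le_left _ _) _).trans hsub₀⟩
  have hKc : IsCompact (Metric.cthickening δ (tsupport g)) := hc.isCompact.cthickening
  let φ : ℕ → ContDiffBump (0 : ℂ) := fun n =>
    { rIn := δ / (n + 1) / 2
      rOut := δ / (n + 1)
      rIn_pos := by positivity
      rIn_lt_rOut := half_lt_self (by positivity) }
  have hφle : ∀ n, (φ n).rOut ≤ δ := fun n => div_le_self hδ.le (by simp)
  have hφlim : Tendsto (fun n => (φ n).rOut) atTop (𝓝 0) := by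
    have := tendsto_one_div_add_atTop_nhds_zero_nat (𝕜 := ℝ)
    have h2 := this.const_mul δ
    rw [mul_zero] at h2
    refine h2.congr fun n => ?_
    simp only [φ]
    ring
  set f : ℕ → ℂ → ℝ := fun n =>
    ((φ n).normed volume ⋆[ContinuousLinearMap.lsmul ℝ ℝ, volume] g) with hf
  have hgl : LocallyIntegrable g := hg.continuous.locallyIntegrable
  have hsmooth : ∀ n, ContDiff ℝ ((⊤ : ℕ∞) : WithTop ℕ∞) (f n) := fun n =>
    (φ n).hasCompactSupport_normed.contDiff_convolution_left _ (φ n).contDiff_normed hgl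
  have hzero : ∀ n, ∀ y ∉ Metric.cthickening δ (tsupport g), f n y = 0 := by
    intro n y hy
    have hgz : ∀ z ∈ Metric.ball y (φ n).rOut, g z = 0 := by
      intro z hz
      by_contra hne
      refine hy (Metric.mem_cthickening_of_dist_le y z δ _ (subset_tsupport _ hne) ?_)
      rw [dist_comm]
      exact (Metric.mem_ball.1 hz).le.trans (hφle n)
    have hy0 : g y = 0 := hgz y (Metric.mem_ball_self (φ n).rOut_pos)
    rw [hf]
    simp only
    rw [ContDiffBump.normed_convolution_eq_right fun z hz => (hgz z hz).trans hy0.symm, hy0]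
  have htsupp : ∀ n, tsupport (f n) ⊆ Metric.cthickening δ (tsupport g) := fun n =>
    closure_minimal (fun y hy => by_contra fun h => hy (hzero n y h)) Metric.isClosed_cthickening
  -- The derivative falls on g, which by Rademacher exists almost everywhere. Hence ∇(f n) is a
  -- mollification of ∇g: it inherits the bound C and converges at Lebesgue points.
  have hder : ∀ n y, Integrable (fun t => (φ n).normed volume t • fderiv ℝ g (y - t)) ∧
      HasFDerivAt (f n) (∫ t, (φ n).normed volume t • fderiv ℝ g (y - t)) y := by
    intro n y
    have hρ : Continuous ((φ n).normed volume) := (φ n).continuous_normed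
    have key := hasFDerivAt_integral_of_dominated_loc_of_lip' (𝕜 := ℝ) (μ := (volume : Measure ℂ))
      (F := fun y t => (φ n).normed volume t • g (y - t)) (s := univ) (x₀ := y)
      (F' := fun t => (φ n).normed volume t • fderiv ℝ g (y - t))
      (bound := fun t => (φ n).normed volume t * C) univ_mem
      (fun z _ => (hρ.smul (hg.continuous.comp (by fun_prop))).aestronglyMeasurable)
      ((hρ.smul (hg.continuous.comp (by fun_prop))).integrable_of_hasCompactSupport
        (φ n).hasCompactSupport_normed.smul_right)
      (hρ.measurable.smul ((measurable_fderiv ℝ g).comp (by fun_prop))).aestronglyMeasurable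
      (Eventually.of_forall fun t z _ => by
        rw [← smul_sub, norm_smul, Real.norm_of_nonneg ((φ n).nonneg_normed t), mul_assoc]
        refine mul_le_mul_of_nonneg_left ?_ ((φ n).nonneg_normed t)
        have := hg.dist_le_mul (z - t) (y - t)
        rw [dist_eq_norm, dist_eq_norm, sub_sub_sub_cancel_right] at this
        exact this)
      ((φ n).integrable_normed.mul_const _)
      (by
        have h1 : ∀ᵐ t : ℂ, DifferentiableAt ℝ g (y - t) :=
          (Measure.measurePreserving_sub_left volume y).quasiMeasurePreserving.ae hg.ae_differentiableAt
        filter_upwards [h1] with t ht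
        have h2 : HasFDerivAt (fun z => g (z - t)) (fderiv ℝ g (y - t)) y := by
          have h3 := HasFDerivAt.comp y ht.hasFDerivAt ((hasFDerivAt_id y).sub_const t)
          rwa [ContinuousLinearMap.comp_id] at h3
        exact h2.const_smul ((φ n).normed volume t))
    exact key
  refine ⟨_, hKc, hsub, f, fun n => ⟨hsmooth n, hKc.of_isClosed_subset (isClosed_tsupport _)
    (htsupp n), (htsupp n).trans hsub⟩, htsupp, fun y => ?_, fun n y => ?_, fun n y => ?_, ?_⟩
  · exact ContDiffBump.convolution_tendsto_right_of_continuous hφlim hg.continuous y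
  · rw [← Real.dist_eq]
    refine ContDiffBump.dist_normed_convolution_le hg.continuous.aestronglyMeasurable fun z hz => ?_
    refine (hg.dist_le_mul z y).trans ?_
    have : dist z y ≤ 1 := (Metric.mem_ball.1 hz).le.trans ((hφle n).trans hδ1)
    exact mul_le_of_le_one_right C.2 this
  · rw [(hder n y).2.fderiv]
    refine (norm_integral_le_of_norm_le ((φ n).integrable_normed.mul_const (C : ℝ))
      (Eventually.of_forall fun t => ?_)).trans ?_
    · rw [norm_smul, Real.norm_of_nonneg ((φ n).nonneg_normed t)]
      exact mul_le_mul_of_nonneg_left (norm_fderiv_le_of_lipschitz ℝ hg) ((φ n).nonneg_normed t)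
    · rw [integral_mul_const, (φ n).integral_normed, one_mul]
  · have hloc : LocallyIntegrable (fderiv ℝ g) := by
      refine LocallyIntegrable.mono (continuous_const (y := (C : ℝ))).locallyIntegrable
        (measurable_fderiv ℝ g).aestronglyMeasurable (Eventually.of_forall fun t => ?_)
      exact (norm_fderiv_le_of_lipschitz ℝ hg).trans (le_abs_self _)
    -- The factor 2 is the ratio of outer to inner radius of the bumps.
    have := ContDiffBump.ae_convolution_tendsto_right_of_locallyIntegrable (K := 2) hφlim
      (Eventually.of_forall fun n => by simp only [φ]; linarith) hloc
    filter_upwards [this] with y hy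
    refine hy.congr fun n => ?_
    rw [(hder n y).2.fderiv]
    rfl

lemma isFiniteMeasure_restrict_of_isBounded {D : Set ℂ} (hb : Bornology.IsBounded D) :
    IsFiniteMeasure (volume.restrict D) :=
  ⟨by rw [Measure.restrict_apply_univ]; exact hb.measure_lt_top⟩

lemma isFiniteMeasure_dirichletMeasure {D : Set ℂ} (hb : Bornology.IsBounded D) :
    IsFiniteMeasure (dirichletMeasure D) := by
  have := isFiniteMeasure_restrict_of_isBounded hb
  exact Measure.smul_finite _ ENNReal.ofReal_ne_top

lemma integral_dirichletMeasure (D : Set ℂ) (F : ℂ → ℝ) :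
    ∫ y, F y ∂(dirichletMeasure D) = (2 * π)⁻¹ * ∫ y in D, F y := by
  rw [dirichletMeasure, integral_smul_measure, ENNReal.toReal_ofReal (by positivity), one_div,
    smul_eq_mul]

lemma ae_dirichletMeasure {D : Set ℂ} (hD : IsOpen D) {p : ℂ → Prop}
    (h : ∀ᵐ y, y ∈ D → p y) : ∀ᵐ y ∂(dirichletMeasure D), p y :=
  Measure.ae_smul_measure ((ae_restrict_iff' hD.measurableSet).2 h) _

/-- Near the support, compactness gives a constant C. A point where f is nonzero and a point outside
the enlarged ball are at distance at least 1, so there the sup bound M serves as a Lipschitz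
constant. -/
lemma LocallyLipschitz.exists_lipschitzWith_of_hasCompactSupport {f : ℂ → ℝ}
    (hf : LocallyLipschitz f) (hc : HasCompactSupport f) : ∃ C, LipschitzWith C f := by
  obtain ⟨R, hR⟩ := hc.isCompact.isBounded.exists_norm_le
  obtain ⟨C, hC⟩ := (hf.locallyLipschitzOn (s := Metric.closedBall 0 (R + 1))
    ).exists_lipschitzOnWith_of_compact (isCompact_closedBall 0 (R + 1))
  obtain ⟨M, hM⟩ := hc.exists_bound_of_continuous hf.continuous
  have hM0 : 0 ≤ M := (norm_nonneg _).trans (hM 0)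
  have hin : ∀ a, f a ≠ 0 → ‖a‖ ≤ R := fun a ha => hR a (subset_tsupport _ ha)
  have key : ∀ a b, f a ≠ 0 → dist (f a) (f b) ≤ (max C ⟨M, hM0⟩ : ℝ≥0) * dist a b := by
    intro a b ha
    have haR := hin a ha
    by_cases hbR : ‖b‖ ≤ R + 1
    · refine (hC.dist_le_mul a ?_ b ?_).trans ?_
      · rw [mem_closedBall_zero_iff]; linarith
      · rwa [mem_closedBall_zero_iff]
      · exact mul_le_mul_of_nonneg_right (by exact_mod_cast le_max_left _ _) dist_nonneg
    · have hfb : f b = 0 := by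
        by_contra h
        exact hbR ((hin b h).trans (by linarith))
      have hd : 1 ≤ dist a b := by
        rw [dist_comm, dist_eq_norm]
        have := norm_sub_norm_le b a
        push Not at hbR
        linarith
      rw [hfb, dist_zero_right]
      calc ‖f a‖ ≤ M := hM a
        _ ≤ M * dist a b := le_mul_of_one_le_right hM0 hd
        _ ≤ _ := mul_le_mul_of_nonneg_right
          (by exact_mod_cast (le_max_right C (⟨M, hM0⟩ : ℝ≥0))) dist_nonneg
  refine ⟨max C ⟨M, hM0⟩, LipschitzWith.of_dist_le_mul fun a b => ?_⟩
  by_cases ha : f a = 0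
  · by_cases hb : f b = 0
    · rw [ha, hb, dist_self]; positivity
    · rw [dist_comm, dist_comm a]; exact key b a hb
  · exact key a b ha

/-! ### Weak equation for the regularized Green's function -/

section Green

variable {D : Set ℂ} {ε : ℝ}

lemma gradient_regularizedGreen_ae (hreg : DirichletRegular D) (hε : 0 < ε)
    (x : ℂ) : ∀ᵐ y : ℂ, y ∈ D → ∇ (regularizedGreen D ε x) y =
      ∇ (fun w : ℂ => -Real.log (max ε ‖x - w‖)) y +
        ∇ (harmonicExtension D (fun w => Real.log (max ε ‖x - w‖))) y := by
  filter_upwards [(lipschitzWith_log_max hε x).ae_differentiableAt] with y hy hyD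
  have h2 : DifferentiableAt ℝ (harmonicExtension D (fun w => Real.log (max ε ‖x - w‖))) y :=
    ((harmonicPart_spec hreg hε x).harmonic y hyD).1.differentiableAt two_ne_zero
  have h1 : DifferentiableAt ℝ (fun w : ℂ => -Real.log (max ε ‖x - w‖)) y := hy.neg
  rw [gradient, gradient, gradient, ← map_add, ← fderiv_add h1 h2]
  rfl

lemma norm_gradient_neg_log_max_le (hε : 0 < ε) (x y : ℂ) :
    ‖∇ (fun w : ℂ => -Real.log (max ε ‖x - w‖)) y‖ ≤ ε⁻¹ := by
  rw [norm_gradient]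
  refine (norm_fderiv_le_of_lipschitz ℝ (lipschitzWith_log_max hε x).neg).trans ?_
  rw [Real.coe_toNNReal _ (inv_nonneg.2 hε.le)]

/-- The bound is only over compact subsets of D, since nothing controls the gradient of the harmonic
part near ∂D. It supplies the domination when passing from test functions to Lipschitz ones. -/
lemma exists_gradient_regularizedGreen_le (hreg : DirichletRegular D) (hε : 0 < ε)
    (x : ℂ) {K : Set ℂ} (hK : IsCompact K) (hKD : K ⊆ D) :
    ∃ B, ∀ᵐ y : ℂ, y ∈ K → ‖∇ (regularizedGreen D ε x) y‖ ≤ B := by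
  have hc : ContinuousOn (∇ (harmonicExtension D (fun w => Real.log (max ε ‖x - w‖)))) K := by
    intro y hy
    have := ((harmonicPart_spec hreg hε x).harmonic y (hKD hy)).1
    exact ((toDual ℝ ℂ).symm.continuous.continuousAt.comp
      (this.fderiv_right (m := 0) (by norm_num)).continuousAt).continuousWithinAt
  obtain ⟨B, hB⟩ := hK.exists_bound_of_continuousOn hc
  refine ⟨ε⁻¹ + B, ?_⟩
  filter_upwards [gradient_regularizedGreen_ae hreg hε x] with y hy hyK
  rw [hy (hKD hyK)]
  exact (norm_add_le _ _).trans (add_le_add (norm_gradient_neg_log_max_le hε x y) (hB y hyK))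

/-- The defining property of the regularized Green's function, tested on smooth functions. -/
lemma IsTestFunction.integral_inner_gradient_regularizedGreen (hD : IsOpen D)
    (hreg : DirichletRegular D) (hε : 0 < ε) (x : ℂ) {f : ℂ → ℝ} (hf : IsTestFunction D f) :
    ∫ y, (inner ℝ (∇ f y) (∇ (regularizedGreen D ε x) y) : ℝ) ∂(dirichletMeasure D) =
      circleAverage f x ε := by
  have hgc : Continuous (∇ f) :=
    (toDual ℝ ℂ).symm.continuous.comp (hf.smooth.continuous_fderiv (by simp))
  have hz : ∀ y ∉ D, ∇ f y = 0 := fun y hy => by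
    rw [gradient, image_eq_zero_of_notMem_tsupport
      (fun h => hy (hf.support (tsupport_fderiv_subset ℝ h))), map_zero]
  have hgs : HasCompactSupport (∇ f) := by
    refine HasCompactSupport.intro hf.compact fun y hy => ?_
    rw [gradient, image_eq_zero_of_notMem_tsupport (fun h => hy (tsupport_fderiv_subset ℝ h)),
      map_zero]
  have hL : Integrable fun y =>
      (inner ℝ (∇ f y) (∇ (fun w : ℂ => -Real.log (max ε ‖x - w‖)) y) : ℝ) := by
    refine Integrable.mono' ((hgc.norm.integrable_of_hasCompactSupport hgs.norm).mul_const ε⁻¹)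
      (hgc.measurable.inner (measurable_gradient _)).aestronglyMeasurable
      (Eventually.of_forall fun y => ?_)
    exact (norm_inner_le_norm _ _).trans
      (mul_le_mul_of_nonneg_left (norm_gradient_neg_log_max_le hε x y) (norm_nonneg _))
  have hU := integral_inner_gradient_harmonic hf (harmonicPart_spec hreg hε x).harmonic
  have h1 : ∫ y in D, (inner ℝ (∇ f y) (∇ (regularizedGreen D ε x) y) : ℝ) =
      ∫ y in D, ((inner ℝ (∇ f y) (∇ (fun w : ℂ => -Real.log (max ε ‖x - w‖)) y) : ℝ) +
        inner ℝ (∇ f y) (∇ (harmonicExtension D (fun w => Real.log (max ε ‖x - w‖))) y)) := by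
    refine setIntegral_congr_ae hD.measurableSet ?_
    filter_upwards [gradient_regularizedGreen_ae hreg hε x] with y hy hyD
    rw [hy hyD, inner_add_right]
  have h2 := setIntegral_eq_integral_of_forall_compl_eq_zero (μ := (volume : Measure ℂ)) (s := D)
    (f := fun y => ((inner ℝ (∇ f y) (∇ (fun w : ℂ => -Real.log (max ε ‖x - w‖)) y) : ℝ) +
        inner ℝ (∇ f y) (∇ (harmonicExtension D (fun w => Real.log (max ε ‖x - w‖))) y)))
    (fun y hy => by simp only [hz y hy, inner_zero_left, add_zero])
  rw [integral_dirichletMeasure, h1, h2, integral_add hL hU.1, hU.2, add_zero,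
    integral_inner_gradient_neg_log_max (hf.smooth.of_le (by exact_mod_cast le_top)) hf.compact x hε,
    inv_mul_cancel_left₀ (by positivity)]

lemma tendsto_circleAverage_of_bounded {f : ℕ → ℂ → ℝ} {g : ℂ → ℝ} {B : ℝ} (x : ℂ) (r : ℝ)
    (hf : ∀ n, Continuous (f n)) (hB : ∀ n y, |f n y| ≤ B)
    (hlim : ∀ y, Tendsto (fun n => f n y) atTop (𝓝 (g y))) :
    Tendsto (fun n => circleAverage (f n) x r) atTop (𝓝 (circleAverage g x r)) := by
  simp only [circleAverage_def]
  refine Tendsto.const_smul ?_ _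
  refine intervalIntegral.tendsto_integral_filter_of_dominated_convergence (fun _ => B)
    (Eventually.of_forall fun n => ((hf n).comp (continuous_circleMap x r)).aestronglyMeasurable)
    (Eventually.of_forall fun n => Eventually.of_forall fun θ _ => hB n _) (by simp)
    (Eventually.of_forall fun θ _ => hlim _)

lemma memLp_gradient_of_lipschitzWith (hb : Bornology.IsBounded D) {g : ℂ → ℝ} {C : ℝ≥0}
    (hg : LipschitzWith C g) : MemLp (∇ g) 2 (dirichletMeasure D) := by
  have := isFiniteMeasure_dirichletMeasure hb
  refine MemLp.of_bound (measurable_gradient g).aestronglyMeasurable C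
    (Eventually.of_forall fun y => ?_)
  rw [norm_gradient]
  exact norm_fderiv_le_of_lipschitz ℝ hg

/-- Lipschitz functions with compact support in `D` belong to `H¹₀(D)`. -/
lemma LipschitzWith.toLp_gradient_mem_sobolevH10 (hD : IsOpen D) (hb : Bornology.IsBounded D)
    {g : ℂ → ℝ} {C : ℝ≥0} (hg : LipschitzWith C g) (hc : HasCompactSupport g)
    (hs : tsupport g ⊆ D) :
    (memLp_gradient_of_lipschitzWith hb hg).toLp (∇ g) ∈ SobolevH10 D := by
  have := isFiniteMeasure_dirichletMeasure hb
  obtain ⟨K, -, -, f, hf, -, -, -, hfb, hflim⟩ := hg.exists_isTestFunction_tendsto hD hc hs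
  have hfm : ∀ n, MemLp (∇ (f n)) 2 (dirichletMeasure D) := fun n =>
    MemLp.of_bound (measurable_gradient _).aestronglyMeasurable C
      (Eventually.of_forall fun y => by rw [norm_gradient]; exact hfb n y)
  refine mem_closure_of_tendsto (tendsto_toLp_two_of_dominated hfm _ (b := fun _ => (C : ℝ))
    (integrable_const _) (fun n => Eventually.of_forall fun y => ?_) ?_)
    (Eventually.of_forall fun n => ⟨f n, hf n, (hfm n).coeFn_toLp⟩)
  · rw [norm_gradient]; exact hfb n y
  · refine ae_dirichletMeasure hD ?_
    filter_upwards [hflim] with y hy _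
    exact ((toDual ℝ ℂ).symm.continuous.tendsto _).comp hy

/-- The defining property of the regularized Green's function, tested on Lipschitz functions. -/
lemma LipschitzWith.integral_inner_gradient_regularizedGreen (hD : IsOpen D)
    (hb : Bornology.IsBounded D) (hreg : DirichletRegular D) (hε : 0 < ε) (x : ℂ)
    {g : ℂ → ℝ} {C : ℝ≥0} (hg : LipschitzWith C g) (hc : HasCompactSupport g)
    (hs : tsupport g ⊆ D) :
    ∫ y, (inner ℝ (∇ g y) (∇ (regularizedGreen D ε x) y) : ℝ) ∂(dirichletMeasure D) =
      circleAverage g x ε := by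
  have := isFiniteMeasure_dirichletMeasure hb
  obtain ⟨K, hK, hKD, f, hf, hfK, hfg, hfgb, hfb, hflim⟩ :=
    hg.exists_isTestFunction_tendsto hD hc hs
  obtain ⟨B, hB⟩ := exists_gradient_regularizedGreen_le hreg hε x hK hKD
  obtain ⟨M, hM⟩ := hc.exists_bound_of_continuous hg.continuous
  have h1 : Tendsto (fun n => circleAverage (f n) x ε) atTop (𝓝 (circleAverage g x ε)) := by
    refine tendsto_circleAverage_of_bounded (B := C + M) x ε
      (fun n => (hf n).smooth.continuous) (fun n y => ?_) hfg
    have h2 := hM y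
    rw [Real.norm_eq_abs] at h2
    have h3 := abs_add_le (f n y - g y) (g y)
    rw [sub_add_cancel] at h3
    linarith [hfgb n y]
  refine tendsto_nhds_unique ?_ h1
  have h2 : Tendsto (fun n => ∫ y, (inner ℝ (∇ (f n) y) (∇ (regularizedGreen D ε x) y) : ℝ)
      ∂(dirichletMeasure D)) atTop (𝓝 (∫ y, (inner ℝ (∇ g y)
        (∇ (regularizedGreen D ε x) y) : ℝ) ∂(dirichletMeasure D))) := by
    refine tendsto_integral_of_dominated_convergence (fun _ => C * |B|)
      (fun n => ((measurable_gradient _).inner (measurable_gradient _)).aestronglyMeasurable)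
      (integrable_const _) (fun n => ?_) ?_
    · refine ae_dirichletMeasure hD ?_
      filter_upwards [hB] with y hy _
      by_cases hyK : y ∈ K
      · refine (norm_inner_le_norm _ _).trans ?_
        refine mul_le_mul ?_ ((hy hyK).trans (le_abs_self B)) (norm_nonneg _) C.2
        rw [norm_gradient]; exact hfb n y
      · rw [gradient, image_eq_zero_of_notMem_tsupport
          (fun h => hyK (hfK n (tsupport_fderiv_subset ℝ h))), map_zero, inner_zero_left, norm_zero]
        positivity
    · refine ae_dirichletMeasure hD ?_
      filter_upwards [hflim] with y hy _
      have h3 : Tendsto (fun n => ∇ (f n) y) atTop (𝓝 (∇ g y)) :=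
        ((toDual ℝ ℂ).symm.continuous.tendsto _).comp hy
      exact h3.inner tendsto_const_nhds
  refine h2.congr fun n => ?_
  exact (hf n).integral_inner_gradient_regularizedGreen hD hreg hε x

end Green

/-! ### Truncation, finite energy and membership in `SobolevH10` -/

/-- The truncation `(G - δ)⁺` of the regularized Green's function, extended by zero. -/
noncomputable def truncatedGreen (D : Set ℂ) (ε : ℝ) (x : ℂ) (δ : ℝ) : ℂ → ℝ :=
  D.indicator fun y => max (regularizedGreen D ε x y - δ) 0

section Green

variable {D : Set ℂ} {ε δ : ℝ}

lemma truncatedGreen_nonneg (x y : ℂ) : 0 ≤ truncatedGreen D ε x δ y :=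
  indicator_nonneg (fun _ _ => le_max_right _ _) y

/-- The set {G ≥ δ} is closed in the compact closure of D and misses ∂D, where G = 0. -/
lemma truncatedGreen_support (hD : IsOpen D) (hb : Bornology.IsBounded D)
    (hreg : DirichletRegular D) (hε : 0 < ε) (hδ : 0 < δ) (x : ℂ) :
    ∃ K, IsCompact K ∧ K ⊆ D ∧ ∀ y ∉ K, truncatedGreen D ε x δ y = 0 := by
  refine ⟨closure D ∩ regularizedGreen D ε x ⁻¹' Ici δ, ?_, ?_, fun y hy => ?_⟩
  · exact hb.isCompact_closure.of_isClosed_subset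
      ((continuousOn_regularizedGreen hreg hε x).preimage_isClosed_of_isClosed isClosed_closure
        isClosed_Ici) inter_subset_left
  · rintro y ⟨hy, hyδ⟩
    by_contra hyD
    have : y ∈ frontier D := by rw [frontier, hD.interior_eq]; exact ⟨hy, hyD⟩
    rw [mem_preimage, regularizedGreen_frontier hreg hε x y this, mem_Ici] at hyδ
    linarith
  · by_cases hyD : y ∈ D
    · rw [truncatedGreen, indicator_of_mem hyD, max_eq_right]
      by_contra! h
      exact hy ⟨subset_closure hyD, by rw [mem_preimage, mem_Ici]; linarith⟩
    · exact indicator_of_notMem hyD _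

lemma hasCompactSupport_truncatedGreen (hD : IsOpen D) (hb : Bornology.IsBounded D)
    (hreg : DirichletRegular D) (hε : 0 < ε) (hδ : 0 < δ) (x : ℂ) :
    HasCompactSupport (truncatedGreen D ε x δ) ∧ tsupport (truncatedGreen D ε x δ) ⊆ D := by
  obtain ⟨K, hK, hKD, h⟩ := truncatedGreen_support hD hb hreg hε hδ x
  have hsupp : Function.support (truncatedGreen D ε x δ) ⊆ K := fun y hy =>
    by_contra fun hyK => hy (h y hyK)
  exact ⟨HasCompactSupport.intro hK h, (closure_minimal hsupp hK.isClosed).trans hKD⟩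

lemma exists_lipschitzWith_truncatedGreen (hD : IsOpen D) (hb : Bornology.IsBounded D)
    (hreg : DirichletRegular D) (hε : 0 < ε) (hδ : 0 < δ) (x : ℂ) :
    ∃ C, LipschitzWith C (truncatedGreen D ε x δ) := by
  obtain ⟨K, hK, hKD, h⟩ := truncatedGreen_support hD hb hreg hε hδ x
  refine LocallyLipschitz.exists_lipschitzWith_of_hasCompactSupport (fun y => ?_)
    (hasCompactSupport_truncatedGreen hD hb hreg hε hδ x).1
  by_cases hyD : y ∈ D
  · obtain ⟨C, t, ht, hC⟩ := (((harmonicPart_spec hreg hε x).harmonic y hyD).1.of_le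
      (by norm_num : (1 : WithTop ℕ∞) ≤ 2)).exists_lipschitzOnWith
    have h1 : LipschitzOnWith _ (regularizedGreen D ε x) t :=
      ((lipschitzWith_log_max hε x).neg.lipschitzOnWith (s := t)).add hC
    have h2 : LipschitzWith 1 fun s : ℝ => max (s - δ) 0 :=
      LipschitzWith.max_const (LipschitzWith.of_dist_le_mul fun a b => by simp) 0
    refine ⟨1 * (Real.toNNReal ε⁻¹ + C), t ∩ D, inter_mem ht (hD.mem_nhds hyD), fun a ha b hb => ?_⟩
    rw [truncatedGreen, indicator_of_mem ha.2, indicator_of_mem hb.2]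
    exact h2.comp_lipschitzOnWith h1 ha.1 hb.1
  · refine ⟨0, Kᶜ, hK.isClosed.isOpen_compl.mem_nhds fun hyK => hyD (hKD hyK), fun a ha b hb => ?_⟩
    rw [h a ha, h b hb, edist_self]
    exact zero_le

/-- No differentiability is needed: `fderiv` is 0 by default at kinks. This settles the level set G
= δ without showing that it is null. -/
lemma gradient_eq_zero_of_isLocalMin {f : ℂ → ℝ} {y : ℂ} (h : IsLocalMin f y) : ∇ f y = 0 := by
  rw [gradient, h.fderiv_eq_zero, map_zero]

lemma gradient_truncatedGreen_of_lt (hD : IsOpen D) (hreg : DirichletRegular D) (hε : 0 < ε)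
    {x y : ℂ} (hy : y ∈ D) (h : δ < regularizedGreen D ε x y) :
    ∇ (truncatedGreen D ε x δ) y = ∇ (regularizedGreen D ε x) y := by
  have hc : ContinuousAt (regularizedGreen D ε x) y :=
    (continuousOn_regularizedGreen hreg hε x).continuousAt
      (mem_of_superset (hD.mem_nhds hy) subset_closure)
  have e : truncatedGreen D ε x δ =ᶠ[𝓝 y] fun z => regularizedGreen D ε x z - δ := by
    filter_upwards [hD.mem_nhds hy, hc.eventually_const_lt h] with z hz hzδ
    rw [truncatedGreen, indicator_of_mem hz, max_eq_left (by linarith)]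
  rw [gradient, e.fderiv_eq, fderiv_sub_const, gradient]

lemma gradient_truncatedGreen_of_le {x y : ℂ} (hy : y ∈ D) (h : regularizedGreen D ε x y ≤ δ) :
    ∇ (truncatedGreen D ε x δ) y = 0 := by
  refine gradient_eq_zero_of_isLocalMin (Eventually.of_forall fun z => ?_)
  have : truncatedGreen D ε x δ y = 0 := by
    rw [truncatedGreen, indicator_of_mem hy, max_eq_right (by linarith)]
  rw [this]
  exact truncatedGreen_nonneg x z

lemma gradient_regularizedGreen_of_eq_zero (hD : IsOpen D) (hb : Bornology.IsBounded D)
    (hreg : DirichletRegular D) (hε : 0 < ε) {x y : ℂ} (hy : y ∈ D)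
    (h : regularizedGreen D ε x y = 0) : ∇ (regularizedGreen D ε x) y = 0 := by
  refine gradient_eq_zero_of_isLocalMin ?_
  filter_upwards [hD.mem_nhds hy] with z hz
  rw [h]
  exact regularizedGreen_nonneg hD hb hreg hε x z (subset_closure hz)

lemma norm_gradient_truncatedGreen_le (hD : IsOpen D) (hreg : DirichletRegular D) (hε : 0 < ε)
    {x y : ℂ} (hy : y ∈ D) :
    ‖∇ (truncatedGreen D ε x δ) y‖ ≤ ‖∇ (regularizedGreen D ε x) y‖ := by
  rcases le_or_gt (regularizedGreen D ε x y) δ with h | h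
  · rw [gradient_truncatedGreen_of_le hy h, norm_zero]; positivity
  · rw [gradient_truncatedGreen_of_lt hD hreg hε hy h]

/-- Testing the weak equation of G with its own truncation thus yields the energy of the truncation.
-/
lemma inner_gradient_truncatedGreen (hD : IsOpen D) (hreg : DirichletRegular D) (hε : 0 < ε)
    {x y : ℂ} (hy : y ∈ D) :
    (inner ℝ (∇ (truncatedGreen D ε x δ) y) (∇ (regularizedGreen D ε x) y) : ℝ) =
      ‖∇ (truncatedGreen D ε x δ) y‖ ^ 2 := by
  rcases le_or_gt (regularizedGreen D ε x y) δ with h | h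
  · rw [gradient_truncatedGreen_of_le hy h, inner_zero_left, norm_zero]; norm_num
  · rw [gradient_truncatedGreen_of_lt hD hreg hε hy h, real_inner_self_eq_norm_sq]

lemma tendsto_gradient_truncatedGreen (hD : IsOpen D) (hb : Bornology.IsBounded D)
    (hreg : DirichletRegular D) (hε : 0 < ε) {x y : ℂ} (hy : y ∈ D) :
    Tendsto (fun n : ℕ => ∇ (truncatedGreen D ε x (1 / ((n : ℝ) + 1))) y) atTop
      (𝓝 (∇ (regularizedGreen D ε x) y)) := by
  rcases (regularizedGreen_nonneg hD hb hreg hε x y (subset_closure hy)).eq_or_lt with h | h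
  · rw [gradient_regularizedGreen_of_eq_zero hD hb hreg hε hy h.symm]
    refine tendsto_const_nhds.congr fun n => ?_
    rw [gradient_truncatedGreen_of_le hy]
    rw [← h]; positivity
  · refine tendsto_const_nhds.congr' ?_
    filter_upwards [tendsto_one_div_add_atTop_nhds_zero_nat.eventually_lt_const h] with n hn
    rw [gradient_truncatedGreen_of_lt hD hreg hε hy hn]

lemma exists_regularizedGreen_le (hb : Bornology.IsBounded D)
    (hreg : DirichletRegular D) (hε : 0 < ε) (x : ℂ) :
    ∃ M, 0 ≤ M ∧ ∀ y ∈ D, regularizedGreen D ε x y ≤ M := by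
  obtain ⟨M, hM⟩ := hb.isCompact_closure.exists_bound_of_continuousOn
    (continuousOn_regularizedGreen hreg hε x)
  exact ⟨max M 0, le_max_right _ _, fun y hy =>
    ((le_abs_self _).trans (hM y (subset_closure hy))).trans (le_max_left _ _)⟩

lemma truncatedGreen_le {M : ℝ} (hδ : 0 ≤ δ) (hM0 : 0 ≤ M) {x : ℂ}
    (hM : ∀ y ∈ D, regularizedGreen D ε x y ≤ M) (y : ℂ) : truncatedGreen D ε x δ y ≤ M :=
  indicator_apply_le' (fun hy => max_le (by linarith [hM y hy]) hM0) fun _ => hM0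

/-- The regularized Green's function has finite Dirichlet energy. -/
theorem memLp_gradient_regularizedGreen (hD : IsOpen D) (hb : Bornology.IsBounded D)
    (hreg : DirichletRegular D) (hε : 0 < ε) (x : ℂ) :
    MemLp (∇ (regularizedGreen D ε x)) 2 (dirichletMeasure D) := by
  have hfin := isFiniteMeasure_dirichletMeasure hb
  obtain ⟨M, hM0, hM⟩ := exists_regularizedGreen_le hb hreg hε x
  have hmG := (measurable_gradient (regularizedGreen D ε x)).aestronglyMeasurable
    (μ := dirichletMeasure D)
  rw [memLp_two_iff_integrable_sq_norm hmG]
  set T : ℕ → ℂ → ℝ := fun n => truncatedGreen D ε x (1 / ((n : ℝ) + 1)) with hT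
  -- The energy of T n is its average over the circle about x, hence at most sup G ≤ M, whatever n;
  -- Fatou then transfers the bound to G.
  have henergy : ∀ n, ∫⁻ y, ENNReal.ofReal (‖∇ (T n) y‖ ^ 2) ∂(dirichletMeasure D) ≤
      ENNReal.ofReal M := by
    intro n
    have hδ : 0 < 1 / ((n : ℝ) + 1) := by positivity
    obtain ⟨C, hC⟩ := exists_lipschitzWith_truncatedGreen hD hb hreg hε hδ x
    obtain ⟨hc, hs⟩ := hasCompactSupport_truncatedGreen hD hb hreg hε hδ x
    rw [← ofReal_integral_eq_lintegral_ofReal]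
    · refine ENNReal.ofReal_le_ofReal ?_
      have h1 := hC.integral_inner_gradient_regularizedGreen hD hb hreg hε x hc hs
      rw [integral_congr_ae (g := fun y => ‖∇ (T n) y‖ ^ 2) (ae_dirichletMeasure hD
        (Eventually.of_forall fun y hy => inner_gradient_truncatedGreen hD hreg hε hy))] at h1
      rw [h1]
      exact circleAverage_mono_on_of_le_circle (hC.continuous.continuousOn.circleIntegrable')
        fun y _ => truncatedGreen_le hδ.le hM0 hM y
    · exact (memLp_two_iff_integrable_sq_norm
        (measurable_gradient _).aestronglyMeasurable).1 (memLp_gradient_of_lipschitzWith hb hC)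
    · exact Eventually.of_forall fun y => by positivity
  refine ⟨hmG.norm.pow 2, ?_⟩
  rw [hasFiniteIntegral_iff_ofReal (Eventually.of_forall fun y => by positivity)]
  calc ∫⁻ y, ENNReal.ofReal (‖∇ (regularizedGreen D ε x) y‖ ^ 2) ∂(dirichletMeasure D)
      = ∫⁻ y, liminf (fun n => ENNReal.ofReal (‖∇ (T n) y‖ ^ 2)) atTop ∂(dirichletMeasure D) := by
        refine lintegral_congr_ae (ae_dirichletMeasure hD (Eventually.of_forall fun y hy => ?_))
        have := (tendsto_gradient_truncatedGreen (x := x) hD hb hreg hε hy).norm.pow 2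
        exact ((ENNReal.continuous_ofReal.tendsto _).comp this).liminf_eq.symm
    _ ≤ liminf (fun n => ∫⁻ y, ENNReal.ofReal (‖∇ (T n) y‖ ^ 2) ∂(dirichletMeasure D)) atTop :=
        lintegral_liminf_le fun n => ((measurable_gradient _).norm.pow_const 2).ennreal_ofReal
    _ ≤ ENNReal.ofReal M := by
        refine (liminf_le_liminf (Eventually.of_forall henergy)).trans ?_
        rw [liminf_const]
    _ < ⊤ := ENNReal.ofReal_lt_top

/-- The regularized Green's function as an element of `L²(D, dx / (2π))` through its gradient. -/
noncomputable def greenLp (hD : IsOpen D) (hb : Bornology.IsBounded D) (hreg : DirichletRegular D)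
    (hε : 0 < ε) (x : ℂ) : Lp ℂ 2 (dirichletMeasure D) :=
  (memLp_gradient_regularizedGreen hD hb hreg hε x).toLp _

/-- The gradients of the truncations converge pointwise in D and are dominated by |∇G|, now known to
be square integrable. -/
lemma exists_tendsto_greenLp (hD : IsOpen D) (hb : Bornology.IsBounded D)
    (hreg : DirichletRegular D) (hε : 0 < ε) (x : ℂ) :
    ∃ F : ℕ → Lp ℂ 2 (dirichletMeasure D), (∀ n, F n ∈ SobolevH10 D) ∧
      (∀ n, F n =ᵐ[dirichletMeasure D] ∇ (truncatedGreen D ε x (1 / ((n : ℝ) + 1)))) ∧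
      Tendsto F atTop (𝓝 (greenLp hD hb hreg hε x)) := by
  have hδ : ∀ n : ℕ, 0 < 1 / ((n : ℝ) + 1) := fun n => by positivity
  choose C hC using fun n => exists_lipschitzWith_truncatedGreen hD hb hreg hε (hδ n) x
  have hG := memLp_gradient_regularizedGreen hD hb hreg hε x
  refine ⟨fun n => (memLp_gradient_of_lipschitzWith hb (hC n)).toLp _, fun n => ?_, fun n =>
    MemLp.coeFn_toLp _, ?_⟩
  · obtain ⟨hc, hs⟩ := hasCompactSupport_truncatedGreen hD hb hreg hε (hδ n) x
    exact (hC n).toLp_gradient_mem_sobolevH10 hD hb hc hs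
  · exact tendsto_toLp_two_of_dominated _ hG ((memLp_two_iff_integrable_sq_norm hG.1).1 hG)
      (fun n => ae_dirichletMeasure hD (Eventually.of_forall fun y hy =>
        norm_gradient_truncatedGreen_le hD hreg hε hy))
      (ae_dirichletMeasure hD (Eventually.of_forall fun y hy =>
        tendsto_gradient_truncatedGreen hD hb hreg hε hy))

/-- The regularized Green's function belongs to `H¹₀(D)`. -/
theorem greenLp_mem (hD : IsOpen D) (hb : Bornology.IsBounded D) (hreg : DirichletRegular D)
    (hε : 0 < ε) (x : ℂ) : greenLp hD hb hreg hε x ∈ SobolevH10 D := by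
  obtain ⟨F, hF, -, hlim⟩ := exists_tendsto_greenLp hD hb hreg hε x
  exact (Submodule.isClosed_topologicalClosure _).mem_of_tendsto hlim (Eventually.of_forall hF)

lemma tendsto_truncatedGreen (hD : IsOpen D) (hb : Bornology.IsBounded D)
    (hreg : DirichletRegular D) (hε : 0 < ε) (x y : ℂ) :
    Tendsto (fun n : ℕ => truncatedGreen D ε x (1 / ((n : ℝ) + 1)) y) atTop
      (𝓝 (D.indicator (regularizedGreen D ε x) y)) := by
  by_cases hy : y ∈ D
  · simp only [truncatedGreen, indicator_of_mem hy]
    have h := (tendsto_const_nhds (x := regularizedGreen D ε x y)).sub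
      (tendsto_one_div_add_atTop_nhds_zero_nat (𝕜 := ℝ))
    have h2 := h.max (tendsto_const_nhds (x := (0 : ℝ)))
    rwa [sub_zero,
      max_eq_left (regularizedGreen_nonneg hD hb hreg hε x y (subset_closure hy))] at h2
  · simp only [truncatedGreen, indicator_of_notMem hy]
    exact tendsto_const_nhds

lemma tendsto_circleAverage_truncatedGreen (hD : IsOpen D) (hb : Bornology.IsBounded D)
    (hreg : DirichletRegular D) (hε : 0 < ε) (x y : ℂ) :
    Tendsto (fun n : ℕ => circleAverage (truncatedGreen D ε x (1 / ((n : ℝ) + 1))) y ε) atTop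
      (𝓝 (circleAverage (D.indicator (regularizedGreen D ε x)) y ε)) := by
  have hδ : ∀ n : ℕ, 0 < 1 / ((n : ℝ) + 1) := fun n => by positivity
  obtain ⟨M, hM0, hM⟩ := exists_regularizedGreen_le hb hreg hε x
  refine tendsto_circleAverage_of_bounded (B := M) y ε (fun n => ?_) (fun n z => ?_)
    (tendsto_truncatedGreen hD hb hreg hε x)
  · obtain ⟨C, hC⟩ := exists_lipschitzWith_truncatedGreen hD hb hreg hε (hδ n) x
    exact hC.continuous
  · rw [abs_of_nonneg (truncatedGreen_nonneg x z)]
    exact truncatedGreen_le (hδ n).le hM0 hM z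

/-- The Dirichlet inner products of regularized Green's functions are circle averages. -/
theorem inner_greenLp (hD : IsOpen D) (hb : Bornology.IsBounded D) (hreg : DirichletRegular D)
    (hε : 0 < ε) (x y : ℂ) :
    (inner ℝ (greenLp hD hb hreg hε x) (greenLp hD hb hreg hε y) : ℝ) =
      circleAverage (D.indicator (regularizedGreen D ε x)) y ε := by
  have hδ : ∀ n : ℕ, 0 < 1 / ((n : ℝ) + 1) := fun n => by positivity
  obtain ⟨F, -, hF, hlim⟩ := exists_tendsto_greenLp hD hb hreg hε x
  have h1 : Tendsto (fun n => (inner ℝ (F n) (greenLp hD hb hreg hε y) : ℝ)) atTop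
      (𝓝 (inner ℝ (greenLp hD hb hreg hε x) (greenLp hD hb hreg hε y))) :=
    hlim.inner tendsto_const_nhds
  refine tendsto_nhds_unique h1
    ((tendsto_circleAverage_truncatedGreen hD hb hreg hε x y).congr fun n => ?_)
  obtain ⟨C, hC⟩ := exists_lipschitzWith_truncatedGreen hD hb hreg hε (hδ n) x
  obtain ⟨hc, hs⟩ := hasCompactSupport_truncatedGreen hD hb hreg hε (hδ n) x
  rw [← hC.integral_inner_gradient_regularizedGreen hD hb hreg hε y hc hs, L2.inner_def]
  refine integral_congr_ae ?_
  filter_upwards [hF n, (memLp_gradient_regularizedGreen hD hb hreg hε y).coeFn_toLp] with z h2 h3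
  rw [h2, greenLp, h3]

/-- Upper bound for circle averages of the regularized Green's function. -/
lemma inner_greenLp_le (hD : IsOpen D) (hb : Bornology.IsBounded D) (hreg : DirichletRegular D)
    (hε : 0 < ε) {x y : ℂ} {B : ℝ} (hB0 : 0 ≤ B)
    (hB : ∀ z ∈ D, ‖z - y‖ = ε → regularizedGreen D ε x z ≤ B) :
    (inner ℝ (greenLp hD hb hreg hε x) (greenLp hD hb hreg hε y) : ℝ) ≤ B := by
  rw [inner_greenLp]
  refine le_of_tendsto (tendsto_circleAverage_truncatedGreen hD hb hreg hε x y)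
    (Eventually.of_forall fun n => ?_)
  have hδ : 0 < 1 / ((n : ℝ) + 1) := by positivity
  obtain ⟨C, hC⟩ := exists_lipschitzWith_truncatedGreen hD hb hreg hε hδ x
  refine circleAverage_mono_on_of_le_circle hC.continuous.continuousOn.circleIntegrable'
    fun z hz => ?_
  refine indicator_apply_le' (fun hzD => max_le ?_ hB0) fun _ => hB0
  rw [abs_of_pos hε, mem_sphere_iff_norm] at hz
  linarith [hB z hzD hz]

end Green

/-! ### Independent Gaussian series -/

section GaussianSeries

variable {Ω : Type*} [MeasurableSpace Ω] {P : Measure Ω} {a : ℕ → Ω → ℝ}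

lemma charFun_gaussian_partial_sum (hlaw : ∀ n, HasLaw (a n) (gaussianReal 0 1) P)
    (hind : iIndepFun a P) (c : ℕ → ℝ) (N : ℕ) (t : ℝ) :
    charFun (P.map (fun ω => ∑ n ∈ Finset.range N, a n ω * c n)) t =
      Complex.exp (-((∑ n ∈ Finset.range N, c n ^ 2 : ℝ) : ℂ) * t ^ 2 / 2) := by
  have hind' : iIndepFun (fun n ω => a n ω * c n) P :=
    hind.comp (fun n x => x * c n) fun n => by fun_prop
  have hlaw' := fun n => gaussianReal_mul_const (hlaw n) (c n)
  have h1 := iIndepFun.charFun_map_finsetSum_eq_prod (s := Finset.range N)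
    (fun n _ => (hlaw' n).aemeasurable) (hind'.restrict (Finset.range N))
  have h2 : (∑ n ∈ Finset.range N, fun ω => a n ω * c n) =
      fun ω => ∑ n ∈ Finset.range N, a n ω * c n := by ext ω; simp
  rw [h2] at h1
  rw [h1, Finset.prod_apply]
  have h3 : ∀ n ∈ Finset.range N, charFun (P.map fun ω => a n ω * c n) t =
      Complex.exp (-((c n : ℂ) ^ 2) * t ^ 2 / 2) := fun n _ => by
    rw [(hlaw' n).map_eq, charFun_gaussianReal]
    congr 1
    simp
    ring
  rw [Finset.prod_congr rfl h3, ← Complex.exp_sum]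
  congr 1
  push_cast
  rw [← Finset.sum_neg_distrib, Finset.sum_mul, Finset.sum_div]

lemma hasLaw_gaussian_partial_sum [IsProbabilityMeasure P] (hlaw : ∀ n, HasLaw (a n) (gaussianReal 0 1) P)
    (hind : iIndepFun a P) (c : ℕ → ℝ) (N : ℕ) :
    HasLaw (fun ω => ∑ n ∈ Finset.range N, a n ω * c n)
      (gaussianReal 0 (Real.toNNReal (∑ n ∈ Finset.range N, c n ^ 2))) P := by
  have hm : AEMeasurable (fun ω => ∑ n ∈ Finset.range N, a n ω * c n) P :=
    Finset.aemeasurable_fun_sum _ fun n _ => (hlaw n).aemeasurable.mul_const _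
  refine ⟨hm, ?_⟩
  have := Measure.isProbabilityMeasure_map hm
  refine Measure.ext_of_charFun (funext fun t => ?_)
  rw [charFun_gaussian_partial_sum hlaw hind, charFun_gaussianReal,
    Real.coe_toNNReal _ (Finset.sum_nonneg fun n _ => sq_nonneg _)]
  congr 1
  push_cast
  ring

lemma integral_sq_gaussian_partial_sum [IsProbabilityMeasure P] (hlaw : ∀ n, HasLaw (a n) (gaussianReal 0 1) P)
    (hind : iIndepFun a P) (c : ℕ → ℝ) (N : ℕ) :
    Integrable (fun ω => (∑ n ∈ Finset.range N, a n ω * c n) ^ 2) P ∧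
    ∫ ω, (∑ n ∈ Finset.range N, a n ω * c n) ^ 2 ∂P = ∑ n ∈ Finset.range N, c n ^ 2 := by
  have h := hasLaw_gaussian_partial_sum hlaw hind c N
  set v := Real.toNNReal (∑ n ∈ Finset.range N, c n ^ 2)
  have hsq : Integrable (fun x : ℝ => x ^ 2) (gaussianReal 0 v) :=
    (memLp_two_iff_integrable_sq aestronglyMeasurable_id).1 (memLp_id_gaussianReal 2)
  have h1 := h.integral_comp (f := fun x : ℝ => x ^ 2)
    (by fun_prop : Continuous fun x : ℝ => x ^ 2).aestronglyMeasurable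
  refine ⟨?_, ?_⟩
  · have h2 := hsq
    rw [← h.map_eq] at h2
    exact h2.comp_aemeasurable h.aemeasurable
  · refine Eq.trans h1 ?_
    have h2 := variance_of_integral_eq_zero (μ := gaussianReal 0 v) (X := id) aemeasurable_id
      (by simp)
    rw [variance_id_gaussianReal] at h2
    simp only [id_eq] at h2
    rw [← h2, Real.coe_toNNReal _ (Finset.sum_nonneg fun n _ => sq_nonneg _)]

/-- An independent Gaussian series with square summable coefficients converges almost surely. -/
theorem ae_tendsto_gaussian_series [IsProbabilityMeasure P] (hlaw : ∀ n, HasLaw (a n) (gaussianReal 0 1) P)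
    (hind : iIndepFun a P) {c : ℕ → ℝ} (hc : Summable fun n => c n ^ 2) :
    ∀ᵐ ω ∂P, ∃ l, Tendsto (fun N => ∑ n ∈ Finset.range N, a n ω * c n) atTop (𝓝 l) := by
  -- The coordinates are only almost everywhere measurable; measurable versions are needed to define
  -- the natural filtration.
  have hae : ∀ n, a n =ᵐ[P] (hlaw n).aemeasurable.mk (a n) := fun n =>
    (hlaw n).aemeasurable.ae_eq_mk
  set b : ℕ → Ω → ℝ := fun n => (hlaw n).aemeasurable.mk (a n) with hb
  have hbm : ∀ n, Measurable (b n) := fun n => (hlaw n).aemeasurable.measurable_mk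
  have hblaw : ∀ n, HasLaw (b n) (gaussianReal 0 1) P := fun n => (hlaw n).congr (hae n).symm
  have hbind : iIndepFun b P := hind.congr hae
  set Y : ℕ → Ω → ℝ := fun n ω => b n ω * c n with hY
  have hYlaw := fun n => gaussianReal_mul_const (hblaw n) (c n)
  have hYsm : ∀ n, StronglyMeasurable (Y n) := fun n => ((hbm n).mul_const _).stronglyMeasurable
  have hYind : iIndepFun Y P := hbind.comp (fun n x => x * c n) fun n => by fun_prop
  have hYint : ∀ n, Integrable (Y n) P := fun n => by
    have h1 : Integrable id (P.map (Y n)) := by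
      rw [(hYlaw n).map_eq]
      exact memLp_one_iff_integrable.1 (memLp_id_gaussianReal 1)
    exact h1.comp_aemeasurable (hYlaw n).aemeasurable
  have hY0 : ∀ n, ∫ ω, Y n ω ∂P = 0 := fun n => by
    rw [(hYlaw n).integral_eq]
    simp
  -- With N + 1 terms, M N involves exactly Y 0, …, Y N, so it is adapted and its next increment Y
  -- (N + 1) is independent of the past.
  set M : ℕ → Ω → ℝ := fun N ω => ∑ n ∈ Finset.range (N + 1), Y n ω with hM
  have hadp : StronglyAdapted (Filtration.natural Y hYsm) M := by
    intro N
    refine Finset.stronglyMeasurable_fun_sum _ fun n hn => ?_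
    exact (Filtration.stronglyAdapted_natural hYsm n).mono
      ((Filtration.natural Y hYsm).mono (Nat.lt_succ_iff.1 (Finset.mem_range.1 hn)))
  have hMint : ∀ N, Integrable (M N) P := fun N => integrable_finsetSum _ fun n _ => hYint n
  have hmart : Martingale M (Filtration.natural Y hYsm) P := by
    refine martingale_nat hadp hMint fun N => ?_
    have h1 : M (N + 1) = M N + Y (N + 1) := by
      ext ω
      simp only [hM, Pi.add_apply]
      rw [Finset.sum_range_succ]
    rw [h1]
    have h2 := condExp_add (hMint N) (hYint (N + 1)) (Filtration.natural Y hYsm N)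
    have h3 := hYind.condExp_natural_ae_eq_of_lt hYsm (Nat.lt_succ_self N)
    have h4 : P[M N | Filtration.natural Y hYsm N] = M N :=
      condExp_of_stronglyMeasurable (Filtration.le _ N) (hadp N) (hMint N)
    filter_upwards [h2, h3] with ω h5 h6
    rw [h5, Pi.add_apply, h4, h6, hY0, add_zero]
  have hbdd : ∀ N, eLpNorm (M N) 1 P ≤ (Real.toNNReal (1 + ∑' n, c n ^ 2) : ℝ≥0) := by
    intro N
    obtain ⟨h1, h2⟩ := integral_sq_gaussian_partial_sum hblaw hbind c (N + 1)
    rw [eLpNorm_one_eq_lintegral_enorm, ← ofReal_integral_norm_eq_lintegral_enorm (hMint N)]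
    refine ENNReal.ofReal_le_ofReal ?_
    -- The elementary |t| ≤ 1 + t² turns the variance bound into the L¹ bound required for
    -- martingale convergence.
    calc ∫ ω, ‖M N ω‖ ∂P ≤ ∫ ω, (1 + (M N ω) ^ 2) ∂P := by
          refine integral_mono (hMint N).norm ((integrable_const 1).add h1) fun ω => ?_
          simp only [Real.norm_eq_abs]
          nlinarith [sq_nonneg (|M N ω| - 1), sq_abs (M N ω), abs_nonneg (M N ω)]
      _ = 1 + ∑ n ∈ Finset.range (N + 1), c n ^ 2 := by
          rw [← h2]
          have := integral_add (μ := P) (integrable_const (1 : ℝ)) h1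
          simpa using this
      _ ≤ 1 + ∑' n, c n ^ 2 := by
          gcongr
          exact hc.sum_le_tsum _ fun n _ => sq_nonneg _
  filter_upwards [hmart.submartingale.exists_ae_tendsto_of_bdd hbdd, ae_all_iff.2 hae] with
    ω ⟨l, hl⟩ hω
  refine ⟨l, (tendsto_add_atTop_iff_nat 1).1 (hl.congr fun N => ?_)⟩
  simp only [hM, hY]
  exact Finset.sum_congr rfl fun n _ => by rw [hω n]

/-- The sum of an independent Gaussian series is Gaussian. -/
theorem hasLaw_of_tendsto_gaussian_series [IsProbabilityMeasure P] (hlaw : ∀ n, HasLaw (a n) (gaussianReal 0 1) P)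
    (hind : iIndepFun a P) {c : ℕ → ℝ} {v : ℝ} (hc : HasSum (fun n => c n ^ 2) v) {S : Ω → ℝ}
    (hS : ∀ᵐ ω ∂P, Tendsto (fun N => ∑ n ∈ Finset.range N, a n ω * c n) atTop (𝓝 (S ω))) :
    HasLaw S (gaussianReal 0 (Real.toNNReal v)) P := by
  have hv : 0 ≤ v := hc.nonneg fun n => sq_nonneg _
  have hm : ∀ N, AEMeasurable (fun ω => ∑ n ∈ Finset.range N, a n ω * c n) P := fun N =>
    Finset.aemeasurable_fun_sum _ fun n _ => (hlaw n).aemeasurable.mul_const _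
  have hSm : AEMeasurable S P := aemeasurable_of_tendsto_metrizable_ae atTop hm hS
  refine ⟨hSm, ?_⟩
  have := Measure.isProbabilityMeasure_map hSm
  refine Measure.ext_of_charFun (funext fun t => ?_)
  have hchar : ∀ {X : Ω → ℝ}, AEMeasurable X P →
      charFun (P.map X) t = ∫ ω, Complex.exp (t * X ω * Complex.I) ∂P := fun {X} hX => by
    rw [charFun_apply_real, integral_map hX]
    exact (by fun_prop : Continuous fun x : ℝ =>
      Complex.exp (t * x * Complex.I)).aestronglyMeasurable
  have h1 : Tendsto (fun N => charFun (P.map (fun ω => ∑ n ∈ Finset.range N, a n ω * c n)) t)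
      atTop (𝓝 (charFun (P.map S) t)) := by
    rw [hchar hSm]
    simp only [hchar (hm _)]
    refine tendsto_integral_of_dominated_convergence (fun _ => 1) (fun N => ?_)
      (integrable_const _) (fun N => Eventually.of_forall fun ω => ?_) ?_
    · exact (((Complex.measurable_ofReal.comp_aemeasurable (hm N)).const_mul _).mul_const
        _).cexp.aestronglyMeasurable
    · rw [← Complex.ofReal_mul, Complex.norm_exp_ofReal_mul_I]
    · filter_upwards [hS] with ω hω
      exact ((by fun_prop : Continuous fun x : ℝ =>
        Complex.exp (t * x * Complex.I)).tendsto _).comp hω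
  have h2 : Tendsto (fun N => charFun (P.map (fun ω => ∑ n ∈ Finset.range N, a n ω * c n)) t)
      atTop (𝓝 (charFun (gaussianReal 0 (Real.toNNReal v)) t)) := by
    simp only [charFun_gaussian_partial_sum hlaw hind]
    rw [charFun_gaussianReal, Real.coe_toNNReal _ hv]
    have h3 := ((by fun_prop : Continuous fun s : ℝ =>
      Complex.exp (-(s : ℂ) * t ^ 2 / 2)).tendsto v).comp hc.tendsto_sum_nat
    convert h3 using 2
    congr 1
    push_cast
    ring_nf
  exact tendsto_nhds_unique h1 h2

end GaussianSeries

/-! ### Covariance and exponential moments of the regularized field -/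

section GFF

variable {Ω : Type*} [MeasurableSpace Ω] {P : Measure Ω} {D : Set ℂ}
  {ε : ℝ}

lemma dirichletInner_regularizedGreen (hD : IsOpen D) (hb : Bornology.IsBounded D)
    (hreg : DirichletRegular D) (hε : 0 < ε) (x : ℂ) (e : SobolevH10 D) :
    dirichletInner e (regularizedGreen D ε x) =
      inner ℝ e (⟨greenLp hD hb hreg hε x, greenLp_mem hD hb hreg hε x⟩ : SobolevH10 D) := by
  rw [dirichletInner, Submodule.coe_inner, L2.inner_def]
  refine integral_congr_ae ?_
  filter_upwards [(memLp_gradient_regularizedGreen hD hb hreg hε x).coeFn_toLp] with y hy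
  rw [greenLp, hy]

/-- Parseval, available because the Green's functions lie in H¹₀(D), where the basis is complete. -/
lemma hasSum_dirichletInner (hD : IsOpen D) (hb : Bornology.IsBounded D)
    (hreg : DirichletRegular D) (hε : 0 < ε) (h : GaussianFreeField D P) (x y : ℂ) :
    HasSum (fun n => dirichletInner (h.basis n) (regularizedGreen D ε x) *
      dirichletInner (h.basis n) (regularizedGreen D ε y))
      (inner ℝ (greenLp hD hb hreg hε x) (greenLp hD hb hreg hε y)) := by
  have := h.basis.hasSum_inner_mul_inner
    (⟨greenLp hD hb hreg hε x, greenLp_mem hD hb hreg hε x⟩ : SobolevH10 D)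
    ⟨greenLp hD hb hreg hε y, greenLp_mem hD hb hreg hε y⟩
  simp only [dirichletInner_regularizedGreen hD hb hreg hε]
  refine this.congr_fun fun n => ?_
  rw [real_inner_comm]

/-- Almost sure convergence shows that the `limUnder` in `pairing` is a genuine limit, not a default
value. -/
lemma ae_tendsto_pairing [IsProbabilityMeasure P] (hD : IsOpen D) (hb : Bornology.IsBounded D)
    (hreg : DirichletRegular D) (hε : 0 < ε) (h : GaussianFreeField D P) (x : ℂ) :
    ∀ᵐ ω ∂P, Tendsto (fun N => ∑ n ∈ Finset.range N,
      h.coord n ω * dirichletInner (h.basis n) (regularizedGreen D ε x)) atTop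
      (𝓝 (h.pairing (regularizedGreen D ε x) ω)) := by
  have hs := (hasSum_dirichletInner hD hb hreg hε h x x).summable
  simp only [← sq] at hs
  filter_upwards [ae_tendsto_gaussian_series h.law h.indep hs] with ω hω
  exact tendsto_nhds_limUnder hω

/-- The covariance structure of the regularized field. -/
theorem hasLaw_hReg_add [IsProbabilityMeasure P] (hD : IsOpen D) (hb : Bornology.IsBounded D)
    (hreg : DirichletRegular D) (hε : 0 < ε) {h : GaussianFreeField D P} {hReg : ℝ → ℂ → Ω → ℝ}
    (hr : IsRegularization h hReg) {x y : ℂ} (hx : x ∈ D) (hy : y ∈ D) :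
    HasLaw (fun ω => hReg ε x ω + hReg ε y ω) (gaussianReal 0 (Real.toNNReal
      (inner ℝ (greenLp hD hb hreg hε x) (greenLp hD hb hreg hε x) +
      2 * inner ℝ (greenLp hD hb hreg hε x) (greenLp hD hb hreg hε y) +
      inner ℝ (greenLp hD hb hreg hε y) (greenLp hD hb hreg hε y)))) P := by
  have hs := ((hasSum_dirichletInner hD hb hreg hε h x x).add
    ((hasSum_dirichletInner hD hb hreg hε h x y).mul_left 2)).add
    (hasSum_dirichletInner hD hb hreg hε h y y)
  refine hasLaw_of_tendsto_gaussian_series h.law h.indep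
    (c := fun n => dirichletInner (h.basis n) (regularizedGreen D ε x) +
      dirichletInner (h.basis n) (regularizedGreen D ε y)) (hs.congr_fun fun n => by ring) ?_
  filter_upwards [ae_tendsto_pairing hD hb hreg hε h x, ae_tendsto_pairing hD hb hreg hε h y,
    hr.version ε hε x hx, hr.version ε hε y hy] with ω h1 h2 h3 h4
  rw [h3, h4]
  refine (h1.add h2).congr fun N => ?_
  rw [← Finset.sum_add_distrib]
  exact Finset.sum_congr rfl fun n _ => by ring

/-- Exponential moments of the regularized field. -/
theorem integral_exp_hReg_add [IsProbabilityMeasure P] (hD : IsOpen D) (hb : Bornology.IsBounded D)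
    (hreg : DirichletRegular D) (hε : 0 < ε) {h : GaussianFreeField D P} {hReg : ℝ → ℂ → Ω → ℝ}
    (hr : IsRegularization h hReg) (γ : ℝ) {x y : ℂ} (hx : x ∈ D) (hy : y ∈ D) :
    Integrable (fun ω => Real.exp (γ * (hReg ε x ω + hReg ε y ω))) P ∧
    ∫ ω, Real.exp (γ * (hReg ε x ω + hReg ε y ω)) ∂P =
      Real.exp (γ ^ 2 / 2 *
      (inner ℝ (greenLp hD hb hreg hε x) (greenLp hD hb hreg hε x) +
      2 * inner ℝ (greenLp hD hb hreg hε x) (greenLp hD hb hreg hε y) +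
      inner ℝ (greenLp hD hb hreg hε y) (greenLp hD hb hreg hε y))) := by
  have hl := hasLaw_hReg_add hD hb hreg hε hr hx hy
  have hnn : 0 ≤ (inner ℝ (greenLp hD hb hreg hε x) (greenLp hD hb hreg hε x) +
      2 * inner ℝ (greenLp hD hb hreg hε x) (greenLp hD hb hreg hε y) +
      inner ℝ (greenLp hD hb hreg hε y) (greenLp hD hb hreg hε y) : ℝ) := by
    have := real_inner_self_nonneg (x := greenLp hD hb hreg hε x + greenLp hD hb hreg hε y)
    rw [inner_add_add_self,
      real_inner_comm (greenLp hD hb hreg hε x) (greenLp hD hb hreg hε y)] at this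
    linarith
  refine ⟨?_, ?_⟩
  · have h1 := integrable_exp_mul_gaussianReal (μ := 0) (v := Real.toNNReal
      (inner ℝ (greenLp hD hb hreg hε x) (greenLp hD hb hreg hε x) +
      2 * inner ℝ (greenLp hD hb hreg hε x) (greenLp hD hb hreg hε y) +
      inner ℝ (greenLp hD hb hreg hε y) (greenLp hD hb hreg hε y))) γ
    rw [← hl.map_eq] at h1
    exact h1.comp_aemeasurable hl.aemeasurable
  · have h1 := mgf_gaussianReal hl.map_eq γ
    rw [mgf, Real.coe_toNNReal _ hnn] at h1
    rw [h1]
    congr 1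
    ring

end GFF

/-! ### Bounds and exact values of the two-point function -/

section Kernel

variable {D : Set ℂ} {ε R : ℝ}

lemma inner_greenLp_le_log (hD : IsOpen D) (hb : Bornology.IsBounded D) (hreg : DirichletRegular D)
    (hε : 0 < ε) (hεR : ε ≤ R) {x : ℂ} (hR : ∀ y ∈ closure D, ‖x - y‖ ≤ R) (y : ℂ) :
    (inner ℝ (greenLp hD hb hreg hε x) (greenLp hD hb hreg hε y) : ℝ) ≤
      Real.log R - Real.log ε := by
  refine inner_greenLp_le hD hb hreg hε (sub_nonneg.2 (Real.log_le_log hε hεR)) fun z hz _ => ?_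
  refine (regularizedGreen_le hD hb hreg hε hεR hR z (subset_closure hz)).trans ?_
  have := Real.log_le_log hε (le_max_left ε ‖x - z‖)
  linarith

/-- On the circle |z - y| = ε one has |x - y| ≤ |x - z| + ε ≤ 2 max(ε, |x - z|), whence the log 2.
-/
lemma inner_greenLp_le_log_dist (hD : IsOpen D) (hb : Bornology.IsBounded D)
    (hreg : DirichletRegular D) (hε : 0 < ε) (hεR : ε ≤ R) {x y : ℂ}
    (hR : ∀ y ∈ closure D, ‖x - y‖ ≤ R) (hy : y ∈ D) (hxy : x ≠ y) :
    (inner ℝ (greenLp hD hb hreg hε x) (greenLp hD hb hreg hε y) : ℝ) ≤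
      Real.log R + Real.log 2 - Real.log ‖x - y‖ := by
  have hpos : 0 < ‖x - y‖ := norm_pos_iff.2 (sub_ne_zero.2 hxy)
  have hlog2 : 0 < Real.log 2 := Real.log_pos (by norm_num)
  refine inner_greenLp_le hD hb hreg hε ?_ fun z hz hzy => ?_
  · have := Real.log_le_log hpos (hR y (subset_closure hy))
    linarith
  refine (regularizedGreen_le hD hb hreg hε hεR hR z (subset_closure hz)).trans ?_
  have h1 : ‖x - y‖ ≤ 2 * max ε ‖x - z‖ := by
    have : ‖x - y‖ ≤ ‖x - z‖ + ‖z - y‖ := by simpa using norm_add_le (x - z) (z - y)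
    linarith [le_max_left ε ‖x - z‖, le_max_right ε ‖x - z‖]
  have h2 := Real.log_le_log hpos h1
  rw [Real.log_mul two_ne_zero (lt_max_of_lt_left hε).ne'] at h2
  linarith

/-- On the circle about x the truncated logarithm is the constant -log ε, and the harmonic part
averages to its value at the centre. -/
lemma inner_greenLp_self (hD : IsOpen D) (hb : Bornology.IsBounded D)
    (hreg : DirichletRegular D) (hε : 0 < ε) {x : ℂ} (hx : Metric.closedBall x ε ⊆ D) :
    (inner ℝ (greenLp hD hb hreg hε x) (greenLp hD hb hreg hε x) : ℝ) =
      -Real.log ε + greenCorrection D x x := by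
  have hxD : x ∈ D := hx (Metric.mem_closedBall_self hε.le)
  rw [inner_greenLp, ← harmonicPart_eq_greenCorrection hD hb hreg hε hx (subset_closure hxD)]
  have h1 : HarmonicOnNhd (fun z => -Real.log ε +
      harmonicExtension D (fun w => Real.log (max ε ‖x - w‖)) z) (Metric.closedBall x |ε|) := by
    intro z hz
    rw [abs_of_pos hε] at hz
    exact (harmonicAt_const _).add ((harmonicPart_spec hreg hε x).harmonic z (hx hz))
  rw [← InnerProductSpace.HarmonicOnNhd.circleAverage_eq h1]
  refine circleAverage_congr_sphere fun z hz => ?_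
  rw [abs_of_pos hε] at hz
  rw [indicator_of_mem (hx (Metric.sphere_subset_closedBall hz)), regularizedGreen,
    max_eq_left]
  rw [norm_sub_rev]
  exact (mem_sphere_iff_norm.1 hz).le

/-- The separation 2ε < |x - y| keeps the closed disc about y outside the cutoff region of x, so
G^x_ε is harmonic around that disc and the mean value property applies. -/
lemma inner_greenLp_eq_greenFunction (hD : IsOpen D) (hb : Bornology.IsBounded D)
    (hreg : DirichletRegular D) (hε : 0 < ε) {x y : ℂ} (hx : Metric.closedBall x ε ⊆ D)
    (hy : Metric.closedBall y ε ⊆ D) (hxy : 2 * ε < ‖x - y‖) :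
    (inner ℝ (greenLp hD hb hreg hε x) (greenLp hD hb hreg hε y) : ℝ) = greenFunction D x y := by
  have hyD : y ∈ D := hy (Metric.mem_closedBall_self hε.le)
  have hball : ∀ z ∈ Metric.closedBall y ε, ε < ‖x - z‖ := fun z hz => by
    rw [mem_closedBall_iff_norm] at hz
    have : ‖x - y‖ ≤ ‖x - z‖ + ‖z - y‖ := by simpa using norm_add_le (x - z) (z - y)
    linarith
  rw [inner_greenLp, greenFunction,
    ← harmonicPart_eq_greenCorrection hD hb hreg hε hx (subset_closure hyD)]
  have h1 : HarmonicOnNhd (fun z => -Real.log ‖x - z‖ +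
      harmonicExtension D (fun w => Real.log (max ε ‖x - w‖)) z) (Metric.closedBall y |ε|) := by
    intro z hz
    rw [abs_of_pos hε] at hz
    have hxz : x ≠ z := by
      rintro rfl
      have := hball x hz
      rw [sub_self, norm_zero] at this
      linarith
    exact (harmonicAt_log_norm_sub hxz).neg.add ((harmonicPart_spec hreg hε x).harmonic z (hy hz))
  rw [← InnerProductSpace.HarmonicOnNhd.circleAverage_eq h1]
  refine circleAverage_congr_sphere fun z hz => ?_
  rw [abs_of_pos hε] at hz
  have hz' := Metric.sphere_subset_closedBall hz
  rw [indicator_of_mem (hy hz'), regularizedGreen, max_eq_right (hball z hz').le]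

/-- The two point correlation function of `ε ^ (γ² / 2) exp (γ h_ε)`. -/
noncomputable def liouvilleKernel (hD : IsOpen D) (hb : Bornology.IsBounded D)
    (hreg : DirichletRegular D) (hε : 0 < ε) (γ : ℝ) (x y : ℂ) : ℝ :=
  (ε ^ (γ ^ 2 / 2)) ^ 2 * Real.exp (γ ^ 2 / 2 *
    (inner ℝ (greenLp hD hb hreg hε x) (greenLp hD hb hreg hε x) +
    2 * inner ℝ (greenLp hD hb hreg hε x) (greenLp hD hb hreg hε y) +
    inner ℝ (greenLp hD hb hreg hε y) (greenLp hD hb hreg hε y)))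

lemma liouvilleKernel_eq_exp (hD : IsOpen D) (hb : Bornology.IsBounded D)
    (hreg : DirichletRegular D) (hε : 0 < ε) (γ : ℝ) (x y : ℂ) :
    liouvilleKernel hD hb hreg hε γ x y = Real.exp (γ ^ 2 / 2 * (2 * Real.log ε +
    (inner ℝ (greenLp hD hb hreg hε x) (greenLp hD hb hreg hε x) +
    2 * inner ℝ (greenLp hD hb hreg hε x) (greenLp hD hb hreg hε y) +
    inner ℝ (greenLp hD hb hreg hε y) (greenLp hD hb hreg hε y)))) := by
  rw [liouvilleKernel, Real.rpow_def_of_pos hε, ← Real.exp_nat_mul, ← Real.exp_add]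
  congr 1
  push_cast
  ring

lemma liouvilleKernel_nonneg (hD : IsOpen D) (hb : Bornology.IsBounded D)
    (hreg : DirichletRegular D) (hε : 0 < ε) (γ : ℝ) (x y : ℂ) :
    0 ≤ liouvilleKernel hD hb hreg hε γ x y := by
  rw [liouvilleKernel_eq_exp]
  positivity

/-- A crude bound for fixed ε, valid on the diagonal; it serves to show that the density is square
integrable. -/
lemma liouvilleKernel_le (hD : IsOpen D) (hb : Bornology.IsBounded D)
    (hreg : DirichletRegular D) (hε : 0 < ε) (hεR : ε ≤ R) (γ : ℝ) {x y : ℂ}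
    (hRx : ∀ z ∈ closure D, ‖x - z‖ ≤ R) (hRy : ∀ z ∈ closure D, ‖y - z‖ ≤ R) :
    liouvilleKernel hD hb hreg hε γ x y ≤
      Real.exp (γ ^ 2 / 2 * (2 * Real.log ε + 4 * (Real.log R - Real.log ε))) := by
  rw [liouvilleKernel_eq_exp]
  refine Real.exp_le_exp.2 (mul_le_mul_of_nonneg_left ?_ (by positivity))
  linarith [inner_greenLp_le_log hD hb hreg hε hεR hRx x,
    inner_greenLp_le_log hD hb hreg hε hεR hRx y, inner_greenLp_le_log hD hb hreg hε hεR hRy y]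

/-- The normalisation contributes 2 log ε, which cancels the -log ε of each variance bound; the
covariance bound, counted twice, leaves the singularity. The result is uniform in ε ≤ R. -/
lemma liouvilleKernel_le_rpow (hD : IsOpen D) (hb : Bornology.IsBounded D)
    (hreg : DirichletRegular D) (hε : 0 < ε) (hεR : ε ≤ R) (γ : ℝ) {x y : ℂ}
    (hRx : ∀ z ∈ closure D, ‖x - z‖ ≤ R) (hRy : ∀ z ∈ closure D, ‖y - z‖ ≤ R) (hy : y ∈ D)
    (hxy : x ≠ y) :
    liouvilleKernel hD hb hreg hε γ x y ≤
      Real.exp (γ ^ 2 * (2 * Real.log R + Real.log 2)) * ‖x - y‖ ^ (-γ ^ 2) := by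
  rw [liouvilleKernel_eq_exp, Real.rpow_def_of_pos (norm_pos_iff.2 (sub_ne_zero.2 hxy)),
    ← Real.exp_add]
  refine Real.exp_le_exp.2 ?_
  have h := mul_le_mul_of_nonneg_left (a := γ ^ 2 / 2) (add_le_add (add_le_add
    (inner_greenLp_le_log hD hb hreg hε hεR hRx x) (mul_le_mul_of_nonneg_left
    (inner_greenLp_le_log_dist hD hb hreg hε hεR hRx hy hxy) (zero_le_two (α := ℝ))))
    (inner_greenLp_le_log hD hb hreg hε hεR hRy y)) (by positivity)
  rw [mul_add]
  refine (add_le_add_right h _).trans (le_of_eq ?_)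
  ring

/-- For small `ε` the correlation function does not depend on `ε`. -/
lemma liouvilleKernel_eq (hD : IsOpen D) (hDc : IsConnected D) (hb : Bornology.IsBounded D)
    (hreg : DirichletRegular D) (hε : 0 < ε) (γ : ℝ) {x y : ℂ} (hx : Metric.closedBall x ε ⊆ D)
    (hy : Metric.closedBall y ε ⊆ D) (hxy : 2 * ε < ‖x - y‖) :
    liouvilleKernel hD hb hreg hε γ x y =
      (conformalRadius D x * conformalRadius D y) ^ (γ ^ 2 / 2) *
        Real.exp (γ ^ 2 * greenFunction D x y) := by
  rw [liouvilleKernel_eq_exp, inner_greenLp_self hD hb hreg hε hx,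
    inner_greenLp_self hD hb hreg hε hy, inner_greenLp_eq_greenFunction hD hb hreg hε hx hy hxy,
    conformalRadius_eq_exp hD hDc hb hreg (hx (Metric.mem_closedBall_self hε.le)),
    conformalRadius_eq_exp hD hDc hb hreg (hy (Metric.mem_closedBall_self hε.le)),
    ← Real.exp_add, ← Real.exp_mul, ← Real.exp_add]
  congr 1
  ring

end Kernel

/-! ### Second moments by Fubini, and the integrable majorant -/

section SecondMoment

/-- Fubini for the second moment of a random integral. -/
lemma MeasureTheory.MemLp.second_moment_integral {α Ω : Type*} [MeasurableSpace α]
    [MeasurableSpace Ω] {ν : Measure α} [IsFiniteMeasure ν] {P : Measure Ω} [IsProbabilityMeasure P]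
    {X : α × Ω → ℝ} (hX : MemLp X 2 (ν.prod P)) :
    (∀ᵐ ω ∂P, Integrable (fun x => X (x, ω)) ν) ∧
    MemLp (fun ω => ∫ x, X (x, ω) ∂ν) 2 P ∧
    AEStronglyMeasurable (fun p : α × α => ∫ ω, X (p.1, ω) * X (p.2, ω) ∂P) (ν.prod ν) ∧
    ∫ ω, (∫ x, X (x, ω) ∂ν) ^ 2 ∂P =
      ∫ p : α × α, (∫ ω, X (p.1, ω) * X (p.2, ω) ∂P) ∂(ν.prod ν) := by
  have hint : Integrable X (ν.prod P) := hX.integrable one_le_two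
  -- Pulling X back along either projection keeps it in L², since ν × ν projects to the finite
  -- multiple ν(univ) · ν; the product of the two pullbacks is then integrable.
  have hmap : ∀ f : α × α → α, Measurable f → (ν.prod ν).map f = ν univ • ν →
      MemLp (fun q : (α × α) × Ω => X (f q.1, q.2)) 2 ((ν.prod ν).prod P) := by
    intro f hf hfm
    have h1 : ((ν.prod ν).prod P).map (Prod.map f id) = ν univ • ν.prod P := by
      rw [← Measure.map_prod_map _ _ hf measurable_id, hfm, Measure.map_id,
        Measure.prod_smul_left]
    have h2 : MemLp X 2 (((ν.prod ν).prod P).map (Prod.map f id)) := by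
      rw [h1]
      exact hX.smul_measure (measure_ne_top ν univ)
    exact h2.comp_of_map (hf.prodMap measurable_id).aemeasurable
  have hY : Integrable (fun q : (α × α) × Ω => X (q.1.1, q.2) * X (q.1.2, q.2))
      ((ν.prod ν).prod P) :=
    (hmap Prod.fst measurable_fst Measure.map_fst_prod).integrable_mul
      (hmap Prod.snd measurable_snd Measure.map_snd_prod)
  have hsq : ∀ ω, (∫ x, X (x, ω) ∂ν) ^ 2 =
      ∫ p : α × α, X (p.1, ω) * X (p.2, ω) ∂(ν.prod ν) := fun ω => by
    rw [sq, ← integral_prod_mul]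
  have hm : AEStronglyMeasurable (fun ω => ∫ x, X (x, ω) ∂ν) P :=
    hint.integral_prod_right.aestronglyMeasurable
  refine ⟨hint.prod_left_ae, (memLp_two_iff_integrable_sq hm).2 ?_,
    hY.integral_prod_left.aestronglyMeasurable, ?_⟩
  · simp only [hsq]
    exact hY.integral_prod_right
  · simp only [hsq]
    rw [← integral_prod_symm _ hY, integral_prod _ hY]

end SecondMoment

/-- The singularity `|x - y|⁻ˢ` is integrable on bounded planar domains for `s < 2`. -/
lemma integrableOn_norm_sub_rpow {D : Set ℂ} (hD : IsOpen D) (hb : Bornology.IsBounded D) {s : ℝ}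
    (hs : s < 2) : IntegrableOn (fun p : ℂ × ℂ => ‖p.1 - p.2‖ ^ (-s)) (D ×ˢ D) := by
  obtain ⟨R, hR⟩ := hb.exists_norm_le
  have hRpos : 0 < 2 * |R| + 1 := by positivity
  have h1 : IntegrableOn (fun w : ℂ => ‖w‖ ^ (-s)) (Metric.ball 0 (2 * |R| + 1)) := by
    rw [integrableOn_fun_norm_addHaar volume (f := fun t : ℝ => t ^ (-s)), Complex.finrank_real_complex]
    have h2 : IntegrableOn (fun t : ℝ => t ^ (1 - s)) (Ioo 0 (2 * |R| + 1)) :=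
      (intervalIntegral.integrableOn_Ioo_rpow_iff hRpos).2 (by linarith)
    refine h2.congr_fun (fun t ht => ?_) measurableSet_Ioo
    simp only [smul_eq_mul]
    rw [sub_eq_add_neg, Real.rpow_add ht.1, Real.rpow_one, Nat.add_one_sub_one, pow_one]
  -- On D × D the kernel is the integrand of the convolution of the indicator of D with |w|⁻ˢ cut
  -- off to a ball containing all differences of points of D.
  have h3 : Integrable (D.indicator fun _ : ℂ => (1 : ℝ)) :=
    (integrable_indicator_iff hD.measurableSet).2 (integrableOn_const hb.measure_lt_top.ne)
  have h4 := (h3.convolution_integrand (ContinuousLinearMap.mul ℝ ℝ)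
    ((integrable_indicator_iff Metric.isOpen_ball.measurableSet).2 h1)).integrableOn (s := D ×ˢ D)
  refine h4.congr_fun (fun p hp => ?_) (hD.prod hD).measurableSet
  have hmem : p.1 - p.2 ∈ Metric.ball (0 : ℂ) (2 * |R| + 1) := by
    rw [mem_ball_zero_iff]
    have := norm_sub_le p.1 p.2
    linarith [hR p.1 hp.1, hR p.2 hp.2, le_abs_self R]
  simp only [ContinuousLinearMap.mul_apply', indicator_of_mem hp.2, indicator_of_mem hmem, one_mul]

section Moments

variable {Ω : Type*} [MeasurableSpace Ω] {P : Measure Ω} [IsProbabilityMeasure P] {D : Set ℂ}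
  {ε : ℝ} {h : GaussianFreeField D P} {hReg : ℝ → ℂ → Ω → ℝ} {φ : ℂ → ℝ}

lemma integral_liouville_two_point (hD : IsOpen D) (hb : Bornology.IsBounded D)
    (hreg : DirichletRegular D) (hε : 0 < ε) (hr : IsRegularization h hReg) (γ : ℝ) (φ : ℂ → ℝ)
    {x y : ℂ} (hx : x ∈ D) (hy : y ∈ D) :
    Integrable (fun ω => (φ x * (ε ^ (γ ^ 2 / 2) * Real.exp (γ * hReg ε x ω))) *
      (φ y * (ε ^ (γ ^ 2 / 2) * Real.exp (γ * hReg ε y ω)))) P ∧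
    ∫ ω, (φ x * (ε ^ (γ ^ 2 / 2) * Real.exp (γ * hReg ε x ω))) *
      (φ y * (ε ^ (γ ^ 2 / 2) * Real.exp (γ * hReg ε y ω))) ∂P =
      φ x * φ y * liouvilleKernel hD hb hreg hε γ x y := by
  obtain ⟨h1, h2⟩ := integral_exp_hReg_add hD hb hreg hε hr γ hx hy
  have e : (fun ω => (φ x * (ε ^ (γ ^ 2 / 2) * Real.exp (γ * hReg ε x ω))) *
      (φ y * (ε ^ (γ ^ 2 / 2) * Real.exp (γ * hReg ε y ω)))) = fun ω =>
      φ x * φ y * (ε ^ (γ ^ 2 / 2)) ^ 2 * Real.exp (γ * (hReg ε x ω + hReg ε y ω)) := by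
    ext ω
    rw [mul_add, Real.exp_add]
    ring
  rw [e]
  refine ⟨h1.const_mul _, ?_⟩
  rw [integral_const_mul, h2, liouvilleKernel]
  ring

lemma memLp_liouville_density (hD : IsOpen D) (hb : Bornology.IsBounded D)
    (hreg : DirichletRegular D) (hε : 0 < ε) (hr : IsRegularization h hReg) (γ : ℝ)
    (hφ : ContinuousOn φ (closure D)) :
    MemLp (fun q : ℂ × Ω => φ q.1 * (ε ^ (γ ^ 2 / 2) * Real.exp (γ * hReg ε q.1 q.2))) 2
      ((volume.restrict D).prod P) := by
  have hfin := isFiniteMeasure_restrict_of_isBounded hb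
  obtain ⟨M, hM⟩ := hb.isCompact_closure.exists_bound_of_continuousOn hφ
  obtain ⟨R, hR⟩ := hb.closure.exists_norm_le
  have hmφ : AEStronglyMeasurable φ (volume.restrict D) :=
    (hφ.mono subset_closure).aestronglyMeasurable hD.measurableSet
  have hm : AEStronglyMeasurable (fun q : ℂ × Ω => φ q.1 * (ε ^ (γ ^ 2 / 2) *
      Real.exp (γ * hReg ε q.1 q.2))) ((volume.restrict D).prod P) :=
    hmφ.comp_fst.mul ((((hr.measurable ε hε).const_mul γ).exp).const_mul _).aestronglyMeasurable
  have hm2 : AEStronglyMeasurable (fun q : ℂ × Ω => (φ q.1 * (ε ^ (γ ^ 2 / 2) *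
      Real.exp (γ * hReg ε q.1 q.2))) ^ 2) ((volume.restrict D).prod P) := hm.pow 2
  rw [memLp_two_iff_integrable_sq hm, integrable_prod_iff hm2]
  refine ⟨?_, Integrable.of_bound hm2.norm.integral_prod_right'
    (M ^ 2 * Real.exp (γ ^ 2 / 2 * (2 * Real.log ε + 4 * (Real.log (max ε (2 * R)) -
      Real.log ε)))) ?_⟩
  · filter_upwards [ae_restrict_mem hD.measurableSet] with x hx
    refine (integral_liouville_two_point hD hb hreg hε hr γ φ hx hx).1.congr ?_
    exact Eventually.of_forall fun ω => by simp only; ring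
  · filter_upwards [ae_restrict_mem hD.measurableSet] with x hx
    have hRx : ∀ z ∈ closure D, ‖x - z‖ ≤ max ε (2 * R) := fun z hz => by
      have := norm_sub_le x z
      exact le_max_of_le_right (by linarith [hR x (subset_closure hx), hR z hz])
    have h1 := (integral_liouville_two_point hD hb hreg hε hr γ φ hx hx).2
    simp only [← sq] at h1
    simp only [Real.norm_eq_abs, abs_pow, sq_abs]
    rw [h1, abs_mul, abs_pow, sq_abs, abs_of_nonneg (liouvilleKernel_nonneg hD hb hreg hε γ x x)]
    refine mul_le_mul ?_ (liouvilleKernel_le hD hb hreg hε (le_max_left _ _) γ hRx hRx)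
      (liouvilleKernel_nonneg hD hb hreg hε γ x x) (sq_nonneg _)
    rw [← sq_abs]
    exact pow_le_pow_left₀ (abs_nonneg _) (hM x (subset_closure hx)) 2

lemma ae_liouvilleApprox (hε : 0 < ε) (hr : IsRegularization h hReg) (γ : ℝ) (φ : ℂ → ℝ) :
    ∀ᵐ ω ∂P, (Integrable φ (liouvilleApprox D γ ε (fun z => hReg ε z ω)) ↔
      Integrable (fun z => φ z * (ε ^ (γ ^ 2 / 2) * Real.exp (γ * hReg ε z ω)))
        (volume.restrict D)) ∧
      ∫ z, φ z ∂(liouvilleApprox D γ ε (fun z => hReg ε z ω)) =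
        ∫ z in D, φ z * (ε ^ (γ ^ 2 / 2) * Real.exp (γ * hReg ε z ω)) := by
  filter_upwards [(hr.measurable ε hε).aestronglyMeasurable.prodMk_right] with ω hω
  have hm : AEMeasurable (fun z => ENNReal.ofReal (ε ^ (γ ^ 2 / 2) *
      Real.exp (γ * hReg ε z ω))) (volume.restrict D) :=
    (((hω.aemeasurable.const_mul γ).exp).const_mul _).ennreal_ofReal
  have ht : ∀ᵐ z ∂(volume.restrict D), ENNReal.ofReal (ε ^ (γ ^ 2 / 2) *
      Real.exp (γ * hReg ε z ω)) < ⊤ := Eventually.of_forall fun z => ENNReal.ofReal_lt_top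
  have e : ∀ z, (ENNReal.ofReal (ε ^ (γ ^ 2 / 2) * Real.exp (γ * hReg ε z ω))).toReal • φ z =
      φ z * (ε ^ (γ ^ 2 / 2) * Real.exp (γ * hReg ε z ω)) := fun z => by
    rw [ENNReal.toReal_ofReal (by positivity), smul_eq_mul, mul_comm]
  rw [liouvilleApprox, integrable_withDensity_iff_integrable_smul₀' hm ht,
    integral_withDensity_eq_integral_toReal_smul₀ hm ht]
  simp only [e, and_self]

/-- The second moment of `μ_ε(φ)` as a double integral of the two point correlation function. -/
theorem liouvilleApprox_second_moment (hD : IsOpen D) (hb : Bornology.IsBounded D)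
    (hreg : DirichletRegular D) (hε : 0 < ε) (hr : IsRegularization h hReg) (γ : ℝ)
    (hφ : ContinuousOn φ (closure D)) :
    (∀ᵐ ω ∂P, Integrable φ (liouvilleApprox D γ ε (fun z => hReg ε z ω))) ∧
    MemLp (fun ω => ∫ z, φ z ∂(liouvilleApprox D γ ε (fun z => hReg ε z ω))) 2 P ∧
    AEStronglyMeasurable (fun p : ℂ × ℂ => φ p.1 * φ p.2 *
      liouvilleKernel hD hb hreg hε γ p.1 p.2) (volume.restrict (D ×ˢ D)) ∧
    ∫ ω, (∫ z, φ z ∂(liouvilleApprox D γ ε (fun z => hReg ε z ω))) ^ 2 ∂P =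
      ∫ p in D ×ˢ D, φ p.1 * φ p.2 * liouvilleKernel hD hb hreg hε γ p.1 p.2 := by
  have hfin := isFiniteMeasure_restrict_of_isBounded hb
  obtain ⟨h1, h2, h3, h4⟩ :=
    (memLp_liouville_density hD hb hreg hε hr γ hφ).second_moment_integral
  have hae := ae_liouvilleApprox (D := D) hε hr γ φ
  have hvol : (volume.restrict D).prod (volume.restrict D) =
      (volume : Measure (ℂ × ℂ)).restrict (D ×ˢ D) := by
    rw [Measure.volume_eq_prod, Measure.prod_restrict]
  have hK : (fun p : ℂ × ℂ => ∫ ω, (φ p.1 * (ε ^ (γ ^ 2 / 2) * Real.exp (γ * hReg ε p.1 ω))) *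
      (φ p.2 * (ε ^ (γ ^ 2 / 2) * Real.exp (γ * hReg ε p.2 ω))) ∂P)
      =ᵐ[volume.restrict (D ×ˢ D)]
      fun p => φ p.1 * φ p.2 * liouvilleKernel hD hb hreg hε γ p.1 p.2 := by
    filter_upwards [ae_restrict_mem (hD.prod hD).measurableSet] with p hp
    exact (integral_liouville_two_point hD hb hreg hε hr γ φ hp.1 hp.2).2
  rw [hvol] at h3 h4
  refine ⟨?_, h2.ae_eq ?_, h3.congr hK, ?_⟩
  · filter_upwards [h1, hae] with ω h5 h6 using h6.1.2 h5
  · filter_upwards [hae] with ω h6 using h6.2.symm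
  · rw [← integral_congr_ae hK, ← h4]
    refine integral_congr_ae ?_
    filter_upwards [hae] with ω h6
    rw [h6.2]

end Moments

/-! ### Passage to the limit -/

lemma ae_fst_ne_snd : ∀ᵐ p : ℂ × ℂ, p.1 ≠ p.2 := by
  have hs : MeasurableSet {p : ℂ × ℂ | p.1 = p.2} :=
    (isClosed_eq continuous_fst continuous_snd).measurableSet
  rw [ae_iff]
  simp only [not_not]
  rw [Measure.volume_eq_prod, Measure.measure_prod_null hs]
  refine Eventually.of_forall fun x => ?_
  have : Prod.mk x ⁻¹' {p : ℂ × ℂ | p.1 = p.2} = {x} := by ext y; simp [eq_comm]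
  simp only [this, measure_singleton, Pi.zero_apply]

theorem mainTheorem2 {Ω : Type*} [MeasurableSpace Ω] (P : Measure Ω) [IsProbabilityMeasure P]
    (D : Set ℂ) (hD_open : IsOpen D) (hD_conn : IsConnected D) (hD_bdd : Bornology.IsBounded D)
    (hD_reg : DirichletRegular D)
    (h : GaussianFreeField D P) (hReg : ℝ → ℂ → Ω → ℝ) (h_reg : IsRegularization h hReg)
    (γ : ℝ) (hγ0 : 0 ≤ γ) (hγ : γ < Real.sqrt 2)
    (φ : ℂ → ℝ) (hφ : ContinuousOn φ (closure D)) :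
    (∀ ε : ℝ, 0 < ε →
      (∀ᵐ ω ∂P, Integrable φ (liouvilleApprox D γ ε (fun z => hReg ε z ω))) ∧
      MemLp (fun ω => ∫ z, φ z ∂(liouvilleApprox D γ ε (fun z => hReg ε z ω))) 2 P) ∧
    IntegrableOn (fun p : ℂ × ℂ => φ p.1 * φ p.2 *
      (conformalRadius D p.1 * conformalRadius D p.2) ^ (γ ^ 2 / 2) *
      Real.exp (γ ^ 2 * greenFunction D p.1 p.2)) (D ×ˢ D) ∧
    Tendsto
      (fun ε : ℝ => ∫ ω, (∫ z, φ z ∂(liouvilleApprox D γ ε (fun z => hReg ε z ω))) ^ 2 ∂P)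
      (𝓝[>] 0)
      (𝓝 (∫ p in D ×ˢ D, φ p.1 * φ p.2 *
        (conformalRadius D p.1 * conformalRadius D p.2) ^ (γ ^ 2 / 2) *
        Real.exp (γ ^ 2 * greenFunction D p.1 p.2))) := by
  have hγ2 : γ ^ 2 < 2 := (Real.lt_sqrt hγ0).1 hγ
  refine ⟨fun ε hε => ?_, ?_⟩
  · obtain ⟨h1, h2, -, -⟩ :=
      liouvilleApprox_second_moment hD_open hD_bdd hD_reg hε h_reg γ hφ
    exact ⟨h1, h2⟩
  obtain ⟨M, hM⟩ := hD_bdd.isCompact_closure.exists_bound_of_continuousOn hφ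
  obtain ⟨R₀, hR₀⟩ := hD_bdd.closure.exists_norm_le
  -- R bounds all distances within the closure of D, and R ≥ 1 ensures ε ≤ R for every ε ≤ 1.
  set R := max 1 (2 * R₀) with hRdef
  have hR : ∀ x ∈ D, ∀ z ∈ closure D, ‖x - z‖ ≤ R := fun x hx z hz => by
    have := norm_sub_le x z
    exact le_max_of_le_right (by linarith [hR₀ x (subset_closure hx), hR₀ z hz])
  set L : ℂ × ℂ → ℝ := fun p => φ p.1 * φ p.2 *
    (conformalRadius D p.1 * conformalRadius D p.2) ^ (γ ^ 2 / 2) *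
    Real.exp (γ ^ 2 * greenFunction D p.1 p.2) with hL
  -- The kernel takes a proof of 0 < ε as an argument; the value 0 otherwise is never seen by the
  -- filter.
  set F : ℝ → ℂ × ℂ → ℝ := fun ε p => if hε : 0 < ε then
    φ p.1 * φ p.2 * liouvilleKernel hD_open hD_bdd hD_reg hε γ p.1 p.2 else 0 with hF
  set b : ℂ × ℂ → ℝ := fun p => M * M * Real.exp (γ ^ 2 * (2 * Real.log R + Real.log 2)) *
    ‖p.1 - p.2‖ ^ (-γ ^ 2) with hbdef
  have hbint : IntegrableOn b (D ×ˢ D) :=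
    (integrableOn_norm_sub_rpow hD_open hD_bdd hγ2).const_mul _
  have hmem : ∀ᵐ p : ℂ × ℂ ∂(volume.restrict (D ×ˢ D)), p ∈ D ×ˢ D ∧ p.1 ≠ p.2 :=
    (ae_restrict_mem (hD_open.prod hD_open).measurableSet).and (ae_restrict_of_ae ae_fst_ne_snd)
  have hev : ∀ᶠ ε : ℝ in 𝓝[>] 0, 0 < ε ∧ ε ≤ 1 := by
    filter_upwards [Ioc_mem_nhdsGT (zero_lt_one (α := ℝ))] with ε hε using hε
  have hFm : ∀ᶠ ε in 𝓝[>] (0 : ℝ), AEStronglyMeasurable (F ε) (volume.restrict (D ×ˢ D)) := by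
    filter_upwards [hev] with ε hε
    simp only [hF, dif_pos hε.1]
    exact (liouvilleApprox_second_moment hD_open hD_bdd hD_reg hε.1 h_reg γ hφ).2.2.1
  have hFb : ∀ᶠ ε in 𝓝[>] (0 : ℝ), ∀ᵐ p ∂(volume.restrict (D ×ˢ D)), ‖F ε p‖ ≤ b p := by
    filter_upwards [hev] with ε hε
    filter_upwards [hmem] with p hp
    simp only [hF, hbdef, dif_pos hε.1]
    rw [Real.norm_eq_abs, abs_mul, abs_mul,
      abs_of_nonneg (liouvilleKernel_nonneg hD_open hD_bdd hD_reg hε.1 γ _ _),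
      mul_assoc (M * M)]
    have hM1 := hM p.1 (subset_closure hp.1.1)
    have hM2 := hM p.2 (subset_closure hp.1.2)
    rw [Real.norm_eq_abs] at hM1 hM2
    have hM0 : 0 ≤ M := (abs_nonneg _).trans hM1
    exact mul_le_mul (mul_le_mul hM1 hM2 (abs_nonneg _) hM0)
      (liouvilleKernel_le_rpow hD_open hD_bdd hD_reg hε.1 (hε.2.trans (le_max_left _ _)) γ
        (hR _ hp.1.1) (hR _ hp.1.2) hp.1.2 hp.2)
      (liouvilleKernel_nonneg hD_open hD_bdd hD_reg hε.1 γ _ _) (mul_nonneg hM0 hM0)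
  have hFlim : ∀ᵐ p ∂(volume.restrict (D ×ˢ D)), Tendsto (fun ε => F ε p) (𝓝[>] 0) (𝓝 (L p)) := by
    filter_upwards [hmem] with p hp
    obtain ⟨r₁, hr₁, hs₁⟩ := Metric.nhds_basis_closedBall.mem_iff.1 (hD_open.mem_nhds hp.1.1)
    obtain ⟨r₂, hr₂, hs₂⟩ := Metric.nhds_basis_closedBall.mem_iff.1 (hD_open.mem_nhds hp.1.2)
    have hpos : 0 < ‖p.1 - p.2‖ := norm_pos_iff.2 (sub_ne_zero.2 hp.2)
    have hr : 0 < min (min r₁ r₂) (‖p.1 - p.2‖ / 4) := by positivity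
    -- Off the diagonal F ε p is eventually constant, equal to L p as soon as both discs fit in D
    -- and 2ε < |p.1 - p.2|.
    refine tendsto_const_nhds.congr' ?_
    filter_upwards [Ioc_mem_nhdsGT hr] with ε hε
    have h1 : ε ≤ r₁ := hε.2.trans ((min_le_left _ _).trans (min_le_left _ _))
    have h2 : ε ≤ r₂ := hε.2.trans ((min_le_left _ _).trans (min_le_right _ _))
    have h3 : ε ≤ ‖p.1 - p.2‖ / 4 := hε.2.trans (min_le_right _ _)
    simp only [hF, hL, dif_pos hε.1]
    rw [liouvilleKernel_eq hD_open hD_conn hD_bdd hD_reg hε.1 γ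
      ((Metric.closedBall_subset_closedBall h1).trans hs₁)
      ((Metric.closedBall_subset_closedBall h2).trans hs₂) (by linarith)]
    ring
  refine ⟨?_, ?_⟩
  -- Measurability of the limit L is not evident directly; along a sequence ε → 0 it is an almost
  -- everywhere limit of measurable functions, and inherits the majorant b.
  · obtain ⟨u, hu⟩ := exists_seq_tendsto (𝓝[>] (0 : ℝ))
    obtain ⟨N, hN⟩ := eventually_atTop.1 (hu.eventually (hFm.and hFb))
    have hu' : Tendsto (fun n => u (n + N)) atTop (𝓝[>] 0) := (tendsto_add_atTop_iff_nat N).2 hu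
    have hlim : ∀ᵐ p ∂(volume.restrict (D ×ˢ D)),
        Tendsto (fun n => F (u (n + N)) p) atTop (𝓝 (L p)) := by
      filter_upwards [hFlim] with p hp using hp.comp hu'
    refine Integrable.mono' hbint (aestronglyMeasurable_of_tendsto_ae atTop
      (fun n => (hN (n + N) (Nat.le_add_left _ _)).1) hlim) ?_
    filter_upwards [hlim, ae_all_iff.2 fun n => (hN (n + N) (Nat.le_add_left _ _)).2] with p hp hbp
    exact le_of_tendsto hp.norm (Eventually.of_forall hbp)
  · refine (tendsto_integral_filter_of_dominated_convergence b hFm hFb hbint hFlim).congr' ?_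
    filter_upwards [hev] with ε hε
    simp only [hF, dif_pos hε.1]
    exact ((liouvilleApprox_second_moment hD_open hD_bdd hD_reg hε.1 h_reg γ hφ).2.2.2).symm
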